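/- Let $K$ be a field of characteristic zero, $H=\bigoplus_{n\ge 0}H_n$ a graded connected commutative Hopf algebra over $K$, and $A$ a commutative unital $K$-algebra with an idempotent linear operator $R:A\to A$ satisfying the Rota--Baxter relation of weight $\theta=-1$, that is $R(x)R(y)=R\bigl(R(x)y+xR(y)-xy\bigr)$. Let $\mathrm{Lin}(H,A)$ carry the convolution product $\star$, with unit $e_A=\eta_A\circ\varepsilon$, and the operator $\mathcal R(f)=R\circ f$. Let $\gamma:H\to A$ be an algebra morphism and put $a=e_A-\gamma$. The Bogoliubov recursion $$\gamma_-=e_A+\mathcal R(\gamma_-\star a)$$ has a unique solution $\gamma_-\in\mathrm{Lin}(H,A)$ (the counterterm character). Set $x\triangleright y:=\mathcal R(x)\star y-y\star\mathcal R(x)+y\star x$ (the left pre-Lie product of weight $\theta=-1$), $\mathfrak l^{(1)}(a):=a$, $\mathfrak l^{(n+1)}(a):=\mathfrak l^{(n)}(a)\triangleright a$ and $\mathfrak L^{(n)}(a):=\mathcal R(\mathfrak l^{(n)}(a))$. Then $$\gamma_-=\exp_\star\Bigl(\sum_{m>0}\Omega_m\Bigr),$$ where $$\Omega_m=\sum_{\substack{i_1+\cdots+i_n=m\\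 i_1,\dots,i_n>0}}\Bigl(\int_0^1dt_1\int_0^{t_1}dt_2\cdots\int_0^{t_{n-1}}dt_n\sum_{\sigma\in S_n}\frac{(-1)^{d(\sigma)}}{n\binom{n-1}{d(\sigma)}}\,t_{\sigma_n}^{i_1-1}t_{\sigma_{n-1}}^{i_2-1}\cdots t_{\sigma_1}^{i_n-1}\Bigr)\,\mathfrak L^{(i_1)}(a)\star\cdots\star\mathfrak L^{(i_n)}(a).$$ Here $d(\sigma)=|\{i<n:\sigma_i>\sigma_{i+1}\}|$; the coefficients (the iterated integrals) are rational numbers, viewed in $K$; and the series over $m$ and the exponential series $\exp_\star(f)=\sum_{n\ge0}f^{\star n}/n!$ converge for the topology given by the degree filtration (on each $H_N$ the partial sums are eventually constant). Moreover, for every $n\ge 1$, $$\Omega_n=\sum_{|J|=n}\frac{(-1)^{\ell(J)-1}}{\ell(J)}\sum_{K=(k_1,\dots,k_p)\succeq J}\omega(K,J)\ \mathfrak L^{(k_1)}(a)\star\cdots\star\mathfrak L^{(k_p)}(a),$$ where $J$ runs over the compositions of $n$, $\ell(J)$ is the number of parts of $J$, and $J\preceq K$ means that $K$ refines $J$, i.e.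 that $K$ is a concatenation $(K_1,\dots,K_{\ell(J)})$ of compositions whose weights $|K_1|,|K_2|,\dots$ are the successive parts of $J$; in that case $\omega(K,J)=\prod_r\omega(K_r)$ with $\omega(i_1,\dots,i_k)=\bigl(i_1(i_1+i_2)\cdots(i_1+\cdots+i_k)\bigr)^{-1}$. -/

import Mathlib

open WithConv TensorProduct

noncomputable section

namespace Bogoliubov

/-! ### Graded connected Hopf algebras and Rota--Baxter operators -/

/-- The grading `𝓗` of the Hopf algebra `H` (already a grading of the algebra `H`) is connected and
is respected by the coalgebra structure. The antipode of such a Hopf algebra is automatically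
homogeneous. -/
structure IsConnectedGrading {K H : Type*} [Field K] [CommRing H] [HopfAlgebra K H]
    (𝓗 : ℕ → Submodule K H) : Prop where
  connected : 𝓗 0 = Submodule.span K {(1 : H)}
  counit_eq_zero : ∀ n, 0 < n → ∀ x ∈ 𝓗 n, Coalgebra.counit (R := K) x = 0
  comul_mem : ∀ n, ∀ x ∈ 𝓗 n, Coalgebra.comul (R := K) x ∈
    ⨆ (p : ℕ × ℕ) (_ : p.1 + p.2 = n),
      LinearMap.range (TensorProduct.map (𝓗 p.1).subtype (𝓗 p.2).subtype)

/-- The Rota--Baxter relation of weight `θ`. -/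
def IsRotaBaxter {K B : Type*} [Field K] [Ring B] [Algebra K B] (θ : K) (R : B →ₗ[K] B) : Prop :=
  ∀ x y : B, R x * R y = R (R x * y + x * R y + θ • (x * y))

/-- The left Rota--Baxter pre-Lie product `x ▷_θ y = R(x) y - y R(x) - θ y x`. -/
def preLie {K B : Type*} [Field K] [Ring B] [Algebra K B] (θ : K) (R : B →ₗ[K] B) (x y : B) : B :=
  R x * y - y * R x - θ • (y * x)

/-- The left pre-Lie words `𝔩^(1)(a) = a`, `𝔩^(n+1)(a) = 𝔩^(n)(a) ▷_θ a`
(the value at the unused index `0` is `0`). -/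
def preLieWord {K B : Type*} [Field K] [Ring B] [Algebra K B] (θ : K) (R : B →ₗ[K] B) (a : B) :
    ℕ → B
  | 0 => 0
  | 1 => a
  | n + 2 => preLie θ R (preLieWord θ R a (n + 1)) a

/-- `𝔏^(n)(a) = R(𝔩^(n)(a))`. -/
def bigL {K B : Type*} [Field K] [Ring B] [Algebra K B] (θ : K) (R : B →ₗ[K] B) (a : B) (n : ℕ) :
    B :=
  R (preLieWord θ R a n)

/-- For a composition `I = (i_1, …, i_n)`, the product `𝔏^(i_1)(a) ⋯ 𝔏^(i_n)(a)`, in this order. -/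
def bigLProd {K B : Type*} [Field K] [Ring B] [Algebra K B] (θ : K) (R : B →ₗ[K] B) (a : B)
    {m : ℕ} (I : Composition m) : B :=
  (I.blocks.map (bigL θ R a)).prod

/-! ### The convolution algebra `Lin(H, A)` -/

/-- `Lin(H, A)` with the convolution product and unit `e_A = η_A ∘ ε` (as in Mathlib). -/
abbrev Lin (K H A : Type*) [Field K] [CommRing H] [HopfAlgebra K H] [CommRing A] [Algebra K A] :=
  WithConv (H →ₗ[K] A)

/-- The operator `f ↦ R ∘ f` on `Lin(H, A)`. -/
def postComp {K H A : Type*} [Field K] [CommRing H] [HopfAlgebra K H] [CommRing A] [Algebra K A]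
    (R : A →ₗ[K] A) : Lin K H A →ₗ[K] Lin K H A where
  toFun f := toConv (R ∘ₗ f.ofConv)
  map_add' f g := by ext x; simp
  map_smul' c f := by ext x; simp

/-- `a = e_A - γ`. -/
def defect {K H A : Type*} [Field K] [CommRing H] [HopfAlgebra K H] [CommRing A] [Algebra K A]
    (γ : H →ₐ[K] A) : Lin K H A :=
  1 - toConv γ.toLinearMap

/-- Bogoliubov's counterterm recursion `γ₋ = e_A + R ∘ (γ₋ ⋆ (e_A - γ))`. -/
def IsCounterterm {K H A : Type*} [Field K] [CommRing H] [HopfAlgebra K H] [CommRing A]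
    [Algebra K A] (R : A →ₗ[K] A) (γ : H →ₐ[K] A) (γm : Lin K H A) : Prop :=
  γm = 1 + postComp R (γm * defect γ)

/-- If `γ = γ₋^{-1} ⋆ γ₊` with characters `γ₋`, `γ₊` that map the augmentation ideal of `H` to the
image and to the kernel of the projector `R`, then `γ₋` is the counterterm of `γ`. -/
theorem isCounterterm_of_factorization {K H A : Type*} [Field K] [CommRing H] [HopfAlgebra K H]
    [CommRing A] [Algebra K A] (R : A →ₗ[K] A) (γ γm γp : H →ₐ[K] A)
    (hm : ∀ x : H, Coalgebra.counit (R := K) x = 0 → R (γm x) = γm x)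
    (hp : ∀ x : H, Coalgebra.counit (R := K) x = 0 → R (γp x) = 0)
    (hfac : (toConv γm.toLinearMap : Lin K H A) * toConv γ.toLinearMap = toConv γp.toLinearMap) :
    IsCounterterm R γ (toConv γm.toLinearMap) := by
  unfold IsCounterterm defect
  rw [mul_sub, mul_one, hfac]
  ext x
  set e : K := Coalgebra.counit (R := K) x with he
  have hy : Coalgebra.counit (R := K) (x - algebraMap K H e) = 0 := by
    simp [he]
  have h1 := hm _ hy
  have h2 := hp _ hy
  simp only [map_sub, AlgHom.commutes] at h1 h2
  have h3 : (1 : Lin K H A) x = algebraMap K A e := LinearMap.convOne_apply x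
  change γm x = (1 : Lin K H A) x + R (γm x - γp x)
  rw [h3, map_sub]
  have h4 : R (γm x) - R (γp x) = γm x - algebraMap K A e := by
    rw [← h1, sub_eq_zero.1 h2]
  rw [h4]; ring

/-- The series `∑_{i ≥ 0} u i` converges to `f` in `Lin(H, A)` for the topology defined by the
degree filtration: on each homogeneous component the partial sums are eventually equal to `f`. -/
def HasGradedSum {K H A : Type*} [Field K] [CommRing H] [HopfAlgebra K H] [CommRing A]
    [Algebra K A] (𝓗 : ℕ → Submodule K H) (u : ℕ → Lin K H A) (f : Lin K H A) : Prop :=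
  ∀ N : ℕ, ∃ M : ℕ, ∀ m ≥ M, ∀ x ∈ 𝓗 N, (∑ i ∈ Finset.range m, u i).ofConv x = f.ofConv x

/-- `g = exp_⋆(f) = ∑_{n ≥ 0} f^{⋆ n} / n!`. -/
def IsConvExp {K H A : Type*} [Field K] [CommRing H] [HopfAlgebra K H] [CommRing A]
    [Algebra K A] (𝓗 : ℕ → Submodule K H) (f g : Lin K H A) : Prop :=
  HasGradedSum 𝓗 (fun n => ((n.factorial : K)⁻¹) • f ^ n) g

/-! ### The coefficients of the Strichartz expansion -/

/-- The number of descents of a permutation of `{1, …, n}`. -/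
def descents {n : ℕ} (σ : Equiv.Perm (Fin n)) : ℕ :=
  (Finset.univ.filter fun i : Fin n => ∃ h : (i : ℕ) + 1 < n, σ ⟨i + 1, h⟩ < σ i).card

/-- `∫_0^x dt_1 ∫_0^{t_1} dt_2 ⋯ ∫_0^{t_{n-1}} dt_n f(t_1, …, t_n)`. -/
def simplexIntegral : (n : ℕ) → ℝ → ((Fin n → ℝ) → ℝ) → ℝ
  | 0, _, f => f Fin.elim0
  | n + 1, x, f => ∫ t in (0 : ℝ)..x, simplexIntegral n t fun s => f (Fin.cons t s)

/-- For `I = (i_1, …, i_n)`, the real number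
`∫_0^1 dt_1 ∫_0^{t_1} dt_2 ⋯ ∫_0^{t_{n-1}} dt_n
  ∑_σ (-1)^{d(σ)} / (n * binom(n-1, d(σ))) * t_{σ_n}^{i_1 - 1} ⋯ t_{σ_1}^{i_n - 1}`. -/
def strichartzCoeff {m : ℕ} (I : Composition m) : ℝ :=
  simplexIntegral I.length 1 fun t =>
    ∑ σ : Equiv.Perm (Fin I.length),
      (-1 : ℝ) ^ descents σ / (I.length * ((I.length - 1).choose (descents σ) : ℝ)) *
        ∏ j : Fin I.length, t (σ j.rev) ^ (I.blocksFun j - 1)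

/-! ### Refinement of compositions -/

/-- `ω(I) = (i_1 (i_1 + i_2) ⋯ (i_1 + ⋯ + i_k))⁻¹`. -/
def omega (I : List ℕ) : ℚ :=
  (∏ k ∈ Finset.range I.length, ((I.take (k + 1)).sum : ℚ))⁻¹

/-- `D = (K_1, …, K_m)` cuts the composition `K` into consecutive pieces whose weights
`|K_1|, …, |K_m|` are the parts of `J`. -/
def IsDecomposition {n : ℕ} (K J : Composition n) (D : List (List ℕ)) : Prop :=
  D.flatten = K.blocks ∧ D.map List.sum = J.blocks

/-- `J ⪯ K`: each part of `J` is a sum of (consecutive) parts of `K`, i.e. `K` is finer than `J`. -/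
def Finer {n : ℕ} (J K : Composition n) : Prop :=
  ∃ D, IsDecomposition K J D

/-- The decomposition exhibiting `K` as finer than `J` is unique. -/
theorem IsDecomposition.unique {n : ℕ} {K J : Composition n} {D D' : List (List ℕ)}
    (h : IsDecomposition K J D) (h' : IsDecomposition K J D') : D = D' := by
  have key : ∀ (D D' : List (List ℕ)), D.flatten = D'.flatten →
      D.map List.sum = D'.map List.sum → (∀ j ∈ D.flatten, 0 < j) →
      (∀ j ∈ D.map List.sum, 0 < j) → D = D' := by
    intro D
    induction D with
    | nil =>
      intro D' _ h2 _ _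
      simpa using h2.symm
    | cons A D ih =>
      intro D' h1 h2 h3 h4
      cases D' with
      | nil => simp at h2
      | cons A' D' =>
        simp only [List.flatten_cons, List.map_cons, List.cons.injEq] at h1 h2
        have hA : A = A' := by
          rcases List.append_eq_append_iff.1 h1 with ⟨E, hE, hE'⟩ | ⟨E, hE, hE'⟩
          · have hs : E.sum = 0 := by
              have := h2.1
              rw [hE, List.sum_append] at this
              omega
            have hE0 : E = [] := by
              cases E with
              | nil => rfl
              | cons e E =>
                exfalso
                have he : 0 < e := h3 e (by simp [hE'])
                simp at hs
                omega
            simp [hE, hE0]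
          · have hs : E.sum = 0 := by
              have := h2.1
              rw [hE, List.sum_append] at this
              omega
            have hE0 : E = [] := by
              cases E with
              | nil => rfl
              | cons e E =>
                exfalso
                have he : 0 < e := h3 e (by simp [hE])
                simp at hs
                omega
            simp [hE, hE0]
        subst hA
        have h1' : D.flatten = D'.flatten := List.append_cancel_left h1
        rw [ih D' h1' h2.2 (fun j hj => h3 j (by
            simp only [List.flatten_cons, List.mem_append]; exact Or.inr hj))
          (fun j hj => h4 j (by simp only [List.map_cons, List.mem_cons]; exact Or.inr hj))]
  refine key D D' (h.1.trans h'.1.symm) (h.2.trans h'.2.symm) ?_ ?_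
  · rw [h.1]; intro j hj; exact K.blocks_pos hj
  · rw [h.2]; intro j hj; exact J.blocks_pos hj

open Classical in
/-- `ω(K, J) = ∏_k ω(K_k)` for `K` finer than `J`, where `(K_1, …, K_m)` is the decomposition of `K`
along the parts of `J` (and `0` if `K` is not finer than `J`). -/
def omegaRel {n : ℕ} (K J : Composition n) : ℚ :=
  if h : Finer J K then (h.choose.map omega).prod else 0

open Classical in
/-- `∑_{|J| = n} (-1)^{ℓ(J) - 1} / ℓ(J) ∑_{K ⪰ J} ω(K, J) 𝔏^(k_1)(a) ⋯ 𝔏^(k_p)(a)`. -/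
def combinatorialTerm {F B : Type*} [Field F] [Ring B] [Algebra F B] (θ : F) (R : B →ₗ[F] B)
    (a : B) (n : ℕ) : B :=
  ∑ J : Composition n, (((-1 : ℚ) ^ (J.length - 1) / J.length : ℚ) : F) •
    ∑ K ∈ Finset.univ.filter (fun K : Composition n => Finer J K),
      ((omegaRel K J : ℚ) : F) • bigLProd θ R a K

end Bogoliubov

end

/-!
Write `B = Lin(H, A)`, `a = e_A - γ`, `S_0 = 1` and `S_{n+1} = R(S_n a)`. The element `a` vanishes in
degree `0`, so the `S_n` tend to `0` for the degree filtration, and by completeness the recursion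
`γ₋ = 1 + R(γ₋ a)` has the solution `∑ S_n`. It is the only one: the difference `d` of two solutions
satisfies `d = R(d a)` and hence vanishes in every degree.

The algebraic core is the identity `n S_n = S_{n-1} 𝔏^(1)(a) + ⋯ + S_0 𝔏^(n)(a)`
(`succ_smul_atkinson_succ`): the Rota--Baxter relation turns each product `S_k 𝔏^(i)(a)` into `R` of
an expression in which the pre-Lie words telescope. Iterating it yields
`S_n = ∑_I ω(I) 𝔏^(i_1)(a) ⋯ 𝔏^(i_k)(a)` (`atkinson_eq_sum_composition`). Inserting this into the
homogeneous parts of `log (1 + S_1 + S_2 + ⋯)` gives the combinatorial form of `Ω_n`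
(`combinatorialTerm_eq`), and `exp (∑ Ω_n) = ∑ S_n` follows from `exp (log (1 + X)) = 1 + X` for the
truncated series in `K[X]`, evaluated at `γ₋ - 1` (`X_pow_dvd_expPoly_comp_logPoly`,
`isConvExp_of_hasExpansion`).

What remains is an equality of coefficients (`logCoeff_eq_strichartzCoeff`). The iterated integral of
a monomial is a value of `ω` (`simplexIntegral_sum_monomial`). A product `∏ ω(K_r)` over the pieces
of a composition of length `n` is the sum of `ω` over the linear extensions of a disjoint union of
chains (`linExtSum_union`, `linExtSum_pieces`), that is, over the permutations whose descents occur
only at the cuts between pieces. The coefficient of a permutation with `d` descents is therefore the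
sum of `(-1)^|T| / (|T| + 1)` over the sets `T` of cuts that contain `d` given ones, which is
`(-1)^d / (n * binom(n - 1, d))` (`sum_superset_neg_one_pow_div`).
-/

noncomputable section

namespace Bogoliubov

/-! ### Rota--Baxter algebras -/

section RotaBaxter

variable {K B : Type*} [Field K] [Ring B] [Algebra K B]

/-- The iterates `S_0 = 1`, `S_{n+1} = R(S_n a)` of the Bogoliubov (or Atkinson) recursion. -/
def atkinson (R : B →ₗ[K] B) (a : B) : ℕ → B
  | 0 => 1
  | n + 1 => R (atkinson R a n * a)

lemma preLieWord_succ_succ (θ : K) (R : B →ₗ[K] B) (a : B) (i : ℕ) :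
    preLieWord θ R a (i + 2) = bigL θ R a (i + 1) * a
      - a * bigL θ R a (i + 1) - θ • (a * preLieWord θ R a (i + 1)) := rfl

lemma atkinson_succ_mul_bigL {θ : K} {R : B →ₗ[K] B} (hR : IsRotaBaxter θ R) (a : B) (k i : ℕ) :
    atkinson R a (k + 1) * bigL θ R a (i + 1) =
      R (atkinson R a (k + 1) * preLieWord θ R a (i + 1)
        - atkinson R a k * preLieWord θ R a (i + 2)
        + atkinson R a k * bigL θ R a (i + 1) * a) := by
  rw [preLieWord_succ_succ]
  have h := hR (atkinson R a k * a) (preLieWord θ R a (i + 1))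
  change atkinson R a (k + 1) * bigL θ R a (i + 1) = R (atkinson R a (k + 1) * _ +
    atkinson R a k * a * bigL θ R a (i + 1) + _) at h
  rw [h]
  congr 1
  simp only [mul_sub, mul_smul_comm, mul_assoc]
  abel

/-- The Dynkin-type recursion: the iterates `S_n` satisfy
`n S_n = S_{n-1} 𝔏^(1)(a) + ⋯ + S_0 𝔏^(n)(a)`. In the sum obtained from the Rota--Baxter relation
the pre-Lie words telescope. -/
lemma succ_smul_atkinson_succ {θ : K} {R : B →ₗ[K] B} (hR : IsRotaBaxter θ R) (a : B) (n : ℕ) :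
    (n + 1) • atkinson R a (n + 1) =
      ∑ i ∈ Finset.range (n + 1), atkinson R a (n - i) * bigL θ R a (i + 1) := by
  induction n with
  | zero => simp [atkinson, bigL, preLieWord]
  | succ n ih =>
    have hsum : ∑ i ∈ Finset.range (n + 1), atkinson R a (n + 1 - i) * bigL θ R a (i + 1) =
        R (∑ i ∈ Finset.range (n + 1), ((fun j => atkinson R a (n + 1 - j) *
            preLieWord θ R a (j + 1)) i
          - (fun j => atkinson R a (n + 1 - j) * preLieWord θ R a (j + 1)) (i + 1))
          + (∑ i ∈ Finset.range (n + 1), atkinson R a (n - i) * bigL θ R a (i + 1)) * a) := by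
      rw [Finset.sum_mul, ← Finset.sum_add_distrib, map_sum]
      refine Finset.sum_congr rfl fun i hi => ?_
      have h1 : n + 1 - i = (n - i) + 1 := by have := Finset.mem_range.1 hi; omega
      have h2 : n + 1 - (i + 1) = n - i := by omega
      simp only [h1, h2, atkinson_succ_mul_bigL hR]
    -- The last summand `S_0 𝔏^(n+2)(a)` cancels the lower end of the telescoping sum.
    rw [Finset.sum_range_succ, hsum, Finset.sum_range_sub', ← ih]
    have h0 : R (atkinson R a (n + 1) * preLieWord θ R a (0 + 1)) = atkinson R a (n + 1 + 1) := rfl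
    have h1 : R (((n + 1) • atkinson R a (n + 1)) * a) = (n + 1) • atkinson R a (n + 1 + 1) := by
      rw [smul_mul_assoc, map_nsmul]; rfl
    have h2 : atkinson R a 0 = 1 := rfl
    rw [map_add, map_sub, h1, Nat.sub_zero, h0, Nat.sub_self, h2, one_mul, one_mul]
    rw [show bigL θ R a (n + 1 + 1) = R (preLieWord θ R a (n + 1 + 1)) from rfl,
      succ_nsmul _ (n + 1)]
    abel

end RotaBaxter

/-! ### Sums over compositions -/

section Compositions

/-- Summation over the compositions of `n + 1`, sorted by their last part. -/
lemma sum_composition_succ {M : Type*} [AddCommMonoid M] (F : List ℕ → M) (n : ℕ) :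
    ∑ I : Composition (n + 1), F I.blocks =
      ∑ i ∈ Finset.range (n + 1), ∑ I : Composition i, F (I.blocks ++ [n + 1 - i]) := by
  rw [Finset.sum_sigma']
  symm
  refine Finset.sum_bij (fun x hx => ⟨x.2.blocks ++ [n + 1 - x.1], ?_, ?_⟩) ?_ ?_ ?_ ?_
  · intro j hj
    have h1 := Finset.mem_range.1 (Finset.mem_sigma.1 hx).1
    rcases List.mem_append.1 hj with hj | hj
    · exact x.2.blocks_pos hj
    · rw [List.mem_singleton] at hj; omega
  · have h1 := Finset.mem_range.1 (Finset.mem_sigma.1 hx).1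
    rw [List.sum_append, x.2.blocks_sum, List.sum_singleton]
    omega
  · intro _ _; exact Finset.mem_univ _
  · intro x hx y hy h
    have h' := congrArg Composition.blocks h
    exact Composition.sigma_eq_iff_blocks_eq.2 (List.append_inj' h' rfl).1
  · intro I _
    rcases List.eq_nil_or_concat I.blocks with h | ⟨l, k, h⟩
    · have := I.blocks_sum; rw [h] at this; simp at this
    · rw [List.concat_eq_append] at h
      have hs := I.blocks_sum
      rw [h, List.sum_append, List.sum_singleton] at hs
      have hk : 0 < k := I.blocks_pos (by rw [h]; simp)
      refine ⟨⟨l.sum, ⟨l, fun hj => I.blocks_pos (by rw [h]; simp [hj]), rfl⟩⟩, ?_, ?_⟩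
      · simp; omega
      · ext1
        change l ++ [n + 1 - l.sum] = I.blocks
        rw [h, show n + 1 - l.sum = k by omega]
  · intro _ _; rfl

lemma omega_append_singleton (l : List ℕ) (k : ℕ) :
    omega (l ++ [k]) = omega l * ((l.sum + k : ℕ) : ℚ)⁻¹ := by
  unfold omega
  rw [List.length_append, List.length_singleton, Finset.prod_range_succ, mul_inv]
  congr 1
  · congr 1
    refine Finset.prod_congr rfl fun j hj => ?_
    rw [List.take_append_of_le_length (by have := Finset.mem_range.1 hj; omega)]
  · rw [List.take_of_length_le (by simp)]
    simp

variable {K B : Type*} [Field K] [CharZero K] [Ring B] [Algebra K B]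

/-- The noncommutative Bohnenblust--Spitzer identity: `S_n = ∑_I ω(I) 𝔏^(i_1)(a) ⋯ 𝔏^(i_k)(a)`,
the sum running over the compositions `I` of `n`. -/
lemma atkinson_eq_sum_composition {θ : K} {R : B →ₗ[K] B} (hR : IsRotaBaxter θ R) (a : B) (n : ℕ) :
    atkinson R a n = ∑ I : Composition n, ((omega I.blocks : ℚ) : K) • bigLProd θ R a I := by
  induction n using Nat.strong_induction_on with
  | _ n ih =>
  cases n with
  | zero =>
    have : ∀ I : Composition 0, I.blocks = [] := fun I => by simp
    simp [bigLProd, this, omega, atkinson, composition_card]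
  | succ n =>
    have hn : ((n + 1 : ℕ) : K) ≠ 0 := Nat.cast_ne_zero.2 (Nat.succ_ne_zero n)
    have h := succ_smul_atkinson_succ hR a n
    have h' : atkinson R a (n + 1) = ((n + 1 : ℕ) : K)⁻¹ •
        ∑ i ∈ Finset.range (n + 1), atkinson R a (n - i) * bigL θ R a (i + 1) := by
      rw [← h, ← Nat.cast_smul_eq_nsmul K, inv_smul_smul₀ hn]
    refine Eq.trans ?_
      (sum_composition_succ (fun l => ((omega l : ℚ) : K) • (l.map (bigL θ R a)).prod) n).symm
    rw [h', ← Finset.sum_range_reflect, Finset.smul_sum]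
    refine Finset.sum_congr rfl fun i hi => ?_
    have hi' := Finset.mem_range.1 hi
    rw [show n - (n + 1 - 1 - i) = i by omega, show n + 1 - 1 - i + 1 = n + 1 - i by omega,
      ih i hi', Finset.sum_mul, Finset.smul_sum]
    refine Finset.sum_congr rfl fun I _ => ?_
    rw [omega_append_singleton, I.blocks_sum, show i + (n + 1 - i) = n + 1 by omega,
      smul_mul_assoc, smul_smul, bigLProd, List.map_append, List.prod_append]
    push_cast
    simp [mul_comm]

end Compositions

/-! ### Refinements of compositions -/

section Pieces

/-- The lists `(K_1, …, K_m)` of compositions of weights `|K_1|, …, |K_m|` given by `J`. -/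
def pieces : List ℕ → Finset (List (List ℕ))
  | [] => {[]}
  | j :: J => Finset.image₂ (fun I D => Composition.blocks I :: D)
      (Finset.univ : Finset (Composition j)) (pieces J)

lemma mem_pieces {J : List ℕ} {D : List (List ℕ)} :
    D ∈ pieces J ↔ D.map List.sum = J ∧ ∀ j ∈ D.flatten, 0 < j := by
  induction J generalizing D with
  | nil =>
    rw [pieces, Finset.mem_singleton, List.map_eq_nil_iff]
    exact ⟨fun h => ⟨h, by simp [h]⟩, fun h => h.1⟩
  | cons j J ih =>
    simp only [pieces, Finset.mem_image₂, Finset.mem_univ, true_and]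
    constructor
    · rintro ⟨I, D, hD, rfl⟩
      rw [ih] at hD
      refine ⟨by simp [hD.1, I.blocks_sum], fun k hk => ?_⟩
      rw [List.flatten_cons, List.mem_append] at hk
      exact hk.elim (fun h => I.blocks_pos h) (hD.2 k)
    · rintro ⟨h1, h2⟩
      cases D with
      | nil => simp at h1
      | cons l D =>
        simp only [List.map_cons, List.cons.injEq] at h1
        refine ⟨⟨l, fun {i} hi => h2 i (by simp [hi]), h1.1⟩, D, ih.2 ⟨h1.2, fun k hk => ?_⟩, rfl⟩
        exact h2 k (by rw [List.flatten_cons]; exact List.mem_append_right _ hk)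

lemma sum_pieces_cons {M : Type*} [AddCommMonoid M] (F : List (List ℕ) → M) (j : ℕ) (J : List ℕ) :
    ∑ D ∈ pieces (j :: J), F D = ∑ I : Composition j, ∑ D ∈ pieces J, F (I.blocks :: D) := by
  rw [pieces, Finset.image₂, Finset.sum_image, Finset.sum_product]
  · rfl
  rintro ⟨I, D⟩ _ ⟨I', D'⟩ _ h
  have h' := List.cons.inj h
  exact Prod.ext (Composition.ext h'.1) h'.2

variable {K B : Type*} [Field K] [CharZero K] [Ring B] [Algebra K B]

lemma prod_map_atkinson {θ : K} {R : B →ₗ[K] B} (hR : IsRotaBaxter θ R) (a : B) (J : List ℕ) :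
    (J.map (atkinson R a)).prod = ∑ D ∈ pieces J, (((D.map omega).prod : ℚ) : K) •
      (D.flatten.map (bigL θ R a)).prod := by
  induction J with
  | nil => simp [pieces]
  | cons j J ih =>
    rw [sum_pieces_cons, List.map_cons, List.prod_cons, ih, atkinson_eq_sum_composition hR,
      Finset.sum_mul_sum]
    refine Finset.sum_congr rfl fun I _ => Finset.sum_congr rfl fun D _ => ?_
    simp only [List.map_cons, List.prod_cons, List.flatten_cons, List.map_append, List.prod_append,
      Rat.cast_mul, bigLProd, smul_mul_smul_comm]

lemma omegaRel_eq {n : ℕ} {K J : Composition n} {D : List (List ℕ)} (h : IsDecomposition K J D) :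
    omegaRel K J = (D.map omega).prod := by
  have hf : Finer J K := ⟨D, h⟩
  rw [omegaRel, dif_pos hf, IsDecomposition.unique hf.choose_spec h]

open Classical in
lemma sum_finer {n : ℕ} {M : Type*} [AddCommMonoid M] (J : Composition n) (F : ℚ → List ℕ → M) :
    ∑ K ∈ Finset.univ.filter (fun K : Composition n => Finer J K), F (omegaRel K J) K.blocks =
      ∑ D ∈ pieces J.blocks, F (D.map omega).prod D.flatten := by
  symm
  refine Finset.sum_bij (fun D hD => ⟨D.flatten, fun {i} hi => (mem_pieces.1 hD).2 i hi, ?_⟩)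
    ?_ ?_ ?_ ?_
  · rw [List.sum_flatten, (mem_pieces.1 hD).1, J.blocks_sum]
  · intro D hD
    exact Finset.mem_filter.2 ⟨Finset.mem_univ _, D, rfl, (mem_pieces.1 hD).1⟩
  · intro D hD D' hD' h
    have h1 : IsDecomposition ⟨D.flatten, fun {i} hi => (mem_pieces.1 hD).2 i hi, by
      rw [List.sum_flatten, (mem_pieces.1 hD).1, J.blocks_sum]⟩ J D := ⟨rfl, (mem_pieces.1 hD).1⟩
    have h2 := congrArg Composition.blocks h
    exact h1.unique ⟨h2.symm, (mem_pieces.1 hD').1⟩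
  · intro K hK
    obtain ⟨D, hD⟩ := (Finset.mem_filter.1 hK).2
    exact ⟨D, mem_pieces.2 ⟨hD.2, fun j hj => K.blocks_pos (hD.1 ▸ hj)⟩, Composition.ext hD.1⟩
  · intro D hD
    rw [omegaRel_eq (D := D) ⟨rfl, (mem_pieces.1 hD).1⟩]

/-- The combinatorial form of `Ω_n` is the homogeneous part of degree `n` of the logarithm of
`1 + S_1 + S_2 + ⋯`. -/
lemma combinatorialTerm_eq {θ : K} {R : B →ₗ[K] B} (hR : IsRotaBaxter θ R) (a : B) (n : ℕ) :
    combinatorialTerm θ R a n = ∑ J : Composition n,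
      (((-1 : ℚ) ^ (J.length - 1) / J.length : ℚ) : K) • (J.blocks.map (atkinson R a)).prod := by
  classical
  unfold combinatorialTerm
  refine Finset.sum_congr rfl fun J _ => ?_
  rw [prod_map_atkinson hR, ← sum_finer J fun q l => (q : K) • (l.map (bigL θ R a)).prod]
  rfl

open Classical in
/-- The coefficient of `𝔏^(i_1)(a) ⋯ 𝔏^(i_n)(a)` in the combinatorial form of `Ω_m`. -/
def logCoeff {m : ℕ} (I : Composition m) : ℚ :=
  ∑ J ∈ Finset.univ.filter (fun J : Composition m => Finer J I),
    (-1 : ℚ) ^ (J.length - 1) / J.length * omegaRel I J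

lemma combinatorialTerm_eq_sum_logCoeff (θ : K) (R : B →ₗ[K] B) (a : B) (n : ℕ) :
    combinatorialTerm θ R a n =
      ∑ I : Composition n, ((logCoeff I : ℚ) : K) • bigLProd θ R a I := by
  classical
  simp only [combinatorialTerm, logCoeff, Rat.cast_sum, Finset.sum_smul, Finset.smul_sum,
    Finset.sum_filter]
  rw [Finset.sum_comm]
  refine Finset.sum_congr rfl fun I _ => Finset.sum_congr rfl fun J _ => ?_
  split_ifs <;> simp [smul_smul]

end Pieces

/-! ### Truncated exponential and logarithm -/

section TruncatedExpLog

open Polynomial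

variable (K : Type*) [Field K]

/-- The truncation `∑_{n ≤ N} X^n / n!` of the exponential series. -/
def expPoly (N : ℕ) : K[X] := ∑ n ∈ Finset.range (N + 1), C ((n.factorial : K)⁻¹) * X ^ n

/-- The truncation `∑_{k < N} (-1)^k X^(k+1) / (k+1)` of the series of `log (1 + X)`. -/
def logPoly (N : ℕ) : K[X] := ∑ k ∈ Finset.range N, C ((-1) ^ k / ((k : K) + 1)) * X ^ (k + 1)

lemma X_dvd_logPoly (N : ℕ) : X ∣ logPoly K N :=
  Finset.dvd_sum fun k _ => Dvd.dvd.mul_left (dvd_pow_self X (Nat.succ_ne_zero k)) _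

variable [CharZero K]

lemma derivative_expPoly (N : ℕ) :
    derivative (expPoly K N) = expPoly K N - C ((N.factorial : K)⁻¹) * X ^ N := by
  have h : derivative (expPoly K N) =
      ∑ n ∈ Finset.range N, C ((n.factorial : K)⁻¹) * X ^ n := by
    rw [expPoly, derivative_sum, Finset.sum_range_succ']
    simp only [derivative_C_mul, derivative_X_pow]
    simp only [Nat.add_sub_cancel, ← mul_assoc, ← C_mul]
    simp only [Nat.cast_zero, mul_zero, C_0, zero_mul, add_zero]
    refine Finset.sum_congr rfl fun n _ => ?_
    congr 2
    rw [Nat.factorial_succ]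
    have := Nat.cast_ne_zero (R := K).2 (Nat.factorial_ne_zero n)
    have := Nat.cast_ne_zero (R := K).2 (Nat.succ_ne_zero n)
    push_cast at *
    field_simp
  rw [h, expPoly, Finset.sum_range_succ, add_sub_cancel_right]

lemma one_add_X_mul_derivative_logPoly (N : ℕ) :
    (1 + X) * derivative (logPoly K N) = 1 - (-X) ^ N := by
  have h : derivative (logPoly K N) = ∑ k ∈ Finset.range N, (-X) ^ k := by
    rw [logPoly, derivative_sum]
    refine Finset.sum_congr rfl fun k _ => ?_
    rw [derivative_C_mul, derivative_X_pow, Nat.add_sub_cancel, ← mul_assoc, ← C_mul]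
    have := Nat.cast_ne_zero (R := K).2 (Nat.succ_ne_zero k)
    push_cast at *
    rw [div_mul_cancel₀ _ this, neg_pow (X : K[X]) k]
    simp
  rw [h, show (1 + X : K[X]) = 1 - -X by ring]
  exact mul_neg_geom_sum (-X : K[X]) N

/-- `exp (log (1 + X)) = 1 + X` for the truncated series. The composite `F` satisfies
`(1 + X) F' ≡ F` modulo `X ^ N` and `F(0) = 1`, which determines its coefficients up to degree
`N`. -/
lemma X_pow_dvd_expPoly_comp_logPoly (N : ℕ) :
    X ^ (N + 1) ∣ (expPoly K N).comp (logPoly K N) - (1 + X) := by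
  set F := (expPoly K N).comp (logPoly K N) with hF
  have hode : X ^ N ∣ (1 + X) * derivative F - F := by
    have h1 : (1 + X) * derivative F - F = -(F * (-X) ^ N) -
        C ((N.factorial : K)⁻¹) * logPoly K N ^ N * (1 - (-X) ^ N) := by
      rw [hF, derivative_comp, ← mul_assoc, one_add_X_mul_derivative_logPoly, derivative_expPoly]
      simp only [sub_comp, mul_comp, C_comp, pow_comp, X_comp]
      ring
    rw [h1]
    refine dvd_sub (dvd_neg.2 (Dvd.dvd.mul_left (pow_dvd_pow_of_dvd (dvd_neg.2 dvd_rfl) N) _)) ?_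
    exact Dvd.dvd.mul_right (Dvd.dvd.mul_left (pow_dvd_pow_of_dvd (X_dvd_logPoly K N) N) _) _
  have h0 : F.coeff 0 = 1 := by
    obtain ⟨q, hq⟩ := X_dvd_logPoly K N
    rw [coeff_zero_eq_eval_zero, hF, eval_comp, hq, eval_mul, eval_X, zero_mul,
      ← coeff_zero_eq_eval_zero, expPoly, finsetSum_coeff]
    simp [coeff_X_pow]
  have hrec : ∀ k < N, ((k : K) + 1) * F.coeff (k + 1) = (1 - k) * F.coeff k := by
    intro k hk
    have h := X_pow_dvd_iff.1 hode k hk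
    cases k with
    | zero =>
      rw [add_mul, one_mul, coeff_sub, coeff_add, coeff_X_mul_zero, coeff_derivative] at h
      push_cast at *
      linear_combination h
    | succ k =>
      rw [add_mul, one_mul, coeff_sub, coeff_add, coeff_X_mul, coeff_derivative,
        coeff_derivative] at h
      push_cast at *
      linear_combination h
  have hpos : ∀ k, k + 2 ≤ N → F.coeff (k + 2) = 0 := by
    intro k
    induction k with
    | zero =>
      intro hk
      have h := hrec 1 (by omega)
      norm_num at h
      exact h
    | succ k ih =>
      intro hk
      have h := hrec (k + 2) (by omega)
      rw [ih (by omega), mul_zero] at h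
      exact (mul_eq_zero.1 h).resolve_left (by exact_mod_cast Nat.succ_ne_zero (k + 2))
  rw [X_pow_dvd_iff]
  intro d hd
  match d, hd with
  | 0, _ => simp [h0]
  | 1, hd =>
    have h := hrec 0 (by omega)
    simp only [Nat.cast_zero, zero_add, one_mul, sub_zero, h0] at h
    simp [h, coeff_one]
  | k + 2, hd =>
    rw [coeff_sub, hpos k (by omega)]
    simp [coeff_one, coeff_X]

end TruncatedExpLog

/-! ### The degree filtration -/

section Filtration

variable {K H A : Type*} [Field K] [CommRing H] [HopfAlgebra K H] [CommRing A] [Algebra K A]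

lemma isRotaBaxter_postComp {θ : K} {R : A →ₗ[K] A} (hR : IsRotaBaxter θ R) :
    IsRotaBaxter θ (postComp (H := H) R) := by
  intro f g
  have key : ∀ t : H ⊗[K] H,
      LinearMap.mul' K A (TensorProduct.map (R ∘ₗ f.ofConv) (R ∘ₗ g.ofConv) t) =
        R (LinearMap.mul' K A (TensorProduct.map (R ∘ₗ f.ofConv) g.ofConv t) +
          LinearMap.mul' K A (TensorProduct.map f.ofConv (R ∘ₗ g.ofConv) t) +
          θ • LinearMap.mul' K A (TensorProduct.map f.ofConv g.ofConv t)) := by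
    intro t
    induction t using TensorProduct.induction_on with
    | zero => simp
    | tmul x y => simpa using hR (f.ofConv x) (g.ofConv y)
    | add s t hs ht =>
      simp only [map_add, hs, ht, smul_add]
      abel
  ext x
  exact key (Coalgebra.comul (R := K) x)

variable (A) in
/-- The degree filtration of `Lin(H, A)`: the linear maps that vanish in degrees less than `k`. -/
def degFiltration (𝓗 : ℕ → Submodule K H) (k : ℕ) : Submodule K (Lin K H A) where
  carrier := {f | ∀ N < k, ∀ x ∈ 𝓗 N, f.ofConv x = 0}
  add_mem' hf hg N hN x hx := by simp [hf N hN x hx, hg N hN x hx]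
  zero_mem' N hN x hx := by simp
  smul_mem' c f hf N hN x hx := by simp [hf N hN x hx]

variable {𝓗 : ℕ → Submodule K H}

lemma degFiltration_mono {k l : ℕ} (h : k ≤ l) {f : Lin K H A} (hf : f ∈ degFiltration A 𝓗 l) :
    f ∈ degFiltration A 𝓗 k :=
  fun N hN => hf N (hN.trans_le h)

lemma mem_degFiltration_zero (f : Lin K H A) : f ∈ degFiltration A 𝓗 0 :=
  fun _ hN => absurd hN (Nat.not_lt_zero _)

lemma mul_mem_degFiltration (h𝓗 : IsConnectedGrading 𝓗) {i j : ℕ} {f g : Lin K H A}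
    (hf : f ∈ degFiltration A 𝓗 i) (hg : g ∈ degFiltration A 𝓗 j) :
    f * g ∈ degFiltration A 𝓗 (i + j) := by
  intro N hN x hx
  have h := h𝓗.comul_mem N x hx
  change LinearMap.mul' K A (TensorProduct.map f.ofConv g.ofConv (Coalgebra.comul (R := K) x)) = 0
  suffices hle : (⨆ (p : ℕ × ℕ) (_ : p.1 + p.2 = N),
      LinearMap.range (TensorProduct.map (𝓗 p.1).subtype (𝓗 p.2).subtype)) ≤
      LinearMap.ker (LinearMap.mul' K A ∘ₗ TensorProduct.map f.ofConv g.ofConv) from hle h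
  refine iSup₂_le fun p hp => ?_
  rintro _ ⟨t, rfl⟩
  rw [LinearMap.mem_ker]
  induction t using TensorProduct.induction_on with
  | zero => simp
  | tmul y z =>
    simp only [TensorProduct.map_tmul, LinearMap.comp_apply, LinearMap.mul'_apply,
      Submodule.subtype_apply]
    rcases lt_or_ge p.1 i with hi | hi
    · rw [hf _ hi _ y.2, zero_mul]
    · rw [hg p.2 (by omega) _ z.2, mul_zero]
  | add s t hs ht => rw [map_add, map_add, hs, ht, add_zero]

lemma mul_mem_degFiltration_left (h𝓗 : IsConnectedGrading 𝓗) {i : ℕ} {f : Lin K H A}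
    (hf : f ∈ degFiltration A 𝓗 i) (g : Lin K H A) : f * g ∈ degFiltration A 𝓗 i :=
  mul_mem_degFiltration h𝓗 hf (mem_degFiltration_zero g)

lemma mul_mem_degFiltration_right (h𝓗 : IsConnectedGrading 𝓗) {i : ℕ} {f : Lin K H A}
    (hf : f ∈ degFiltration A 𝓗 i) (g : Lin K H A) : g * f ∈ degFiltration A 𝓗 i := by
  simpa using mul_mem_degFiltration h𝓗 (mem_degFiltration_zero g) hf

lemma pow_mem_degFiltration (h𝓗 : IsConnectedGrading 𝓗) {f : Lin K H A}
    (hf : f ∈ degFiltration A 𝓗 1) (n : ℕ) : f ^ n ∈ degFiltration A 𝓗 n := by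
  induction n with
  | zero => exact mem_degFiltration_zero _
  | succ n ih => rw [pow_succ]; exact mul_mem_degFiltration h𝓗 ih hf

lemma pow_sub_pow_mem_degFiltration (h𝓗 : IsConnectedGrading 𝓗) {k : ℕ} {f g : Lin K H A}
    (h : f - g ∈ degFiltration A 𝓗 k) (n : ℕ) : f ^ n - g ^ n ∈ degFiltration A 𝓗 k := by
  induction n with
  | zero => simp
  | succ n ih =>
    have : f ^ (n + 1) - g ^ (n + 1) = (f ^ n - g ^ n) * f + g ^ n * (f - g) := by
      rw [pow_succ, pow_succ]; noncomm_ring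
    rw [this]
    exact add_mem (mul_mem_degFiltration_left h𝓗 ih f) (mul_mem_degFiltration_right h𝓗 h _)

lemma postComp_mem_degFiltration (R : A →ₗ[K] A) {k : ℕ} {f : Lin K H A}
    (hf : f ∈ degFiltration A 𝓗 k) : postComp R f ∈ degFiltration A 𝓗 k := by
  intro N hN x hx
  change R (f.ofConv x) = 0
  rw [hf N hN x hx, map_zero]

lemma defect_mem_degFiltration (h𝓗 : IsConnectedGrading 𝓗) (γ : H →ₐ[K] A) :
    defect γ ∈ degFiltration A 𝓗 1 := by
  intro N hN x hx
  obtain rfl : N = 0 := by omega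
  rw [h𝓗.connected] at hx
  obtain ⟨c, rfl⟩ := Submodule.mem_span_singleton.1 hx
  change (1 : Lin K H A) (c • (1 : H)) - γ (c • (1 : H)) = 0
  rw [LinearMap.convOne_apply]
  simp [Algebra.smul_def]

lemma atkinson_mem_degFiltration (h𝓗 : IsConnectedGrading 𝓗) (R : A →ₗ[K] A) {a : Lin K H A}
    (ha : a ∈ degFiltration A 𝓗 1) (n : ℕ) :
    atkinson (postComp R) a n ∈ degFiltration A 𝓗 n := by
  induction n with
  | zero => exact mem_degFiltration_zero _
  | succ n ih => exact postComp_mem_degFiltration R (mul_mem_degFiltration h𝓗 ih ha)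

lemma prod_atkinson_mem_degFiltration (h𝓗 : IsConnectedGrading 𝓗) (R : A →ₗ[K] A)
    {a : Lin K H A} (ha : a ∈ degFiltration A 𝓗 1) (J : List ℕ) :
    (J.map (atkinson (postComp R) a)).prod ∈ degFiltration A 𝓗 J.sum := by
  induction J with
  | nil => exact mem_degFiltration_zero _
  | cons j J ih =>
    exact mul_mem_degFiltration h𝓗 (atkinson_mem_degFiltration h𝓗 R ha j) ih

variable [GradedAlgebra 𝓗]

lemma eq_zero_of_forall_mem_degFiltration {f : Lin K H A}
    (hf : ∀ k, f ∈ degFiltration A 𝓗 k) : f = 0 := by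
  ext x
  change f.ofConv x = 0
  induction x using DirectSum.Decomposition.inductionOn 𝓗 with
  | zero => exact map_zero _
  | homogeneous m => exact hf _ _ (Nat.lt_succ_self _) _ m.2
  | add x y hx hy => rw [map_add, hx, hy, add_zero]

variable (𝓗) in
/-- `f` is the sum of the series `∑ u i`, whose `i`-th term lies in the `i`-th step of the degree
filtration. -/
structure HasExpansion (u : ℕ → Lin K H A) (f : Lin K H A) : Prop where
  mem : ∀ i, u i ∈ degFiltration A 𝓗 i
  sub_mem : ∀ k, f - ∑ i ∈ Finset.range k, u i ∈ degFiltration A 𝓗 k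

omit [GradedAlgebra 𝓗] in
lemma HasExpansion.hasGradedSum {u : ℕ → Lin K H A} {f : Lin K H A}
    (h : HasExpansion 𝓗 u f) : HasGradedSum 𝓗 u f := by
  intro N
  refine ⟨N + 1, fun m hm x hx => ?_⟩
  have := h.sub_mem m N hm x hx
  exact (sub_eq_zero.1 this).symm

/-- `Lin(H, A)` is complete for the degree filtration. -/
lemma exists_hasExpansion {u : ℕ → Lin K H A} (hu : ∀ i, u i ∈ degFiltration A 𝓗 i) :
    ∃ f, HasExpansion 𝓗 u f := by
  let φ : (DirectSum ℕ fun i => 𝓗 i) →ₗ[K] A := DirectSum.toModule K ℕ A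
    fun N => (∑ i ∈ Finset.range (N + 1), u i).ofConv ∘ₗ (𝓗 N).subtype
  refine ⟨toConv (φ ∘ₗ (DirectSum.decomposeLinearEquiv 𝓗).toLinearMap), hu, fun k N hN x hx => ?_⟩
  have h1 : φ (DirectSum.decompose 𝓗 x) = (∑ i ∈ Finset.range (N + 1), u i).ofConv x := by
    rw [DirectSum.decompose_of_mem 𝓗 hx]
    exact DirectSum.toModule_lof (M := fun i => 𝓗 i) K N _
  change φ (DirectSum.decompose 𝓗 x) - (∑ i ∈ Finset.range k, u i).ofConv x = 0
  rw [h1]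
  have h2 : (∑ i ∈ Finset.range k, u i) - ∑ i ∈ Finset.range (N + 1), u i ∈
      degFiltration A 𝓗 (N + 1) := by
    rw [← Finset.sum_sdiff (Finset.range_subset_range.2 (Nat.succ_le_of_lt hN)),
      add_sub_cancel_right]
    refine Submodule.sum_mem _ fun i hi => degFiltration_mono ?_ (hu i)
    simpa using (Finset.mem_sdiff.1 hi).2
  exact sub_eq_zero.2 (sub_eq_zero.1 (h2 N (Nat.lt_succ_self N) x hx)).symm

omit [GradedAlgebra 𝓗] in
lemma HasExpansion.mul (h𝓗 : IsConnectedGrading 𝓗) {u v : ℕ → Lin K H A} {f g : Lin K H A}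
    (hf : HasExpansion 𝓗 u f) (hg : HasExpansion 𝓗 v g) :
    HasExpansion 𝓗 (fun n => ∑ i ∈ Finset.range (n + 1), u i * v (n - i)) (f * g) := by
  refine ⟨fun n => Submodule.sum_mem _ fun i hi => ?_, fun k => ?_⟩
  · have := mul_mem_degFiltration h𝓗 (hf.mem i) (hg.mem (n - i))
    rwa [Nat.add_sub_cancel' (Nat.lt_succ_iff.1 (Finset.mem_range.1 hi))] at this
  · rw [Finset.sum_range_diag_flip k fun i j => u i * v j]
    have : f * g - ∑ m ∈ Finset.range k, ∑ j ∈ Finset.range (k - m), u m * v j =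
        (f - ∑ i ∈ Finset.range k, u i) * g +
          ∑ m ∈ Finset.range k, u m * (g - ∑ j ∈ Finset.range (k - m), v j) := by
      simp only [mul_sub, sub_mul, Finset.sum_sub_distrib, Finset.mul_sum, Finset.sum_mul]
      abel
    rw [this]
    refine add_mem (mul_mem_degFiltration_left h𝓗 (hf.sub_mem k) g)
      (Submodule.sum_mem _ fun m hm => ?_)
    have := mul_mem_degFiltration h𝓗 (hf.mem m) (hg.sub_mem (k - m))
    rwa [Nat.add_sub_cancel' (Finset.mem_range.1 hm).le] at this

omit [GradedAlgebra 𝓗] in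
lemma HasExpansion.sum_smul {ι : Type*} {u : ι → ℕ → Lin K H A} {f : ι → Lin K H A} (s : Finset ι)
    (c : ι → K) (h : ∀ j, HasExpansion 𝓗 (u j) (f j)) :
    HasExpansion 𝓗 (fun n => ∑ j ∈ s, c j • u j n) (∑ j ∈ s, c j • f j) := by
  refine ⟨fun n => Submodule.sum_mem _ fun j _ => Submodule.smul_mem _ _ ((h j).mem n),
    fun k => ?_⟩
  rw [Finset.sum_comm]
  simp only [← Finset.smul_sum, ← Finset.sum_sub_distrib, ← smul_sub]
  exact Submodule.sum_mem _ fun j _ => Submodule.smul_mem _ _ ((h j).sub_mem k)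

end Filtration

/-! ### Existence and uniqueness of the counterterm -/

section Counterterm

variable {K H A : Type*} [Field K] [CommRing H] [HopfAlgebra K H] [CommRing A] [Algebra K A]
  {𝓗 : ℕ → Submodule K H} [GradedAlgebra 𝓗]

lemma IsCounterterm.eq (h𝓗 : IsConnectedGrading 𝓗) {R : A →ₗ[K] A} {γ : H →ₐ[K] A}
    {f g : Lin K H A} (hf : IsCounterterm R γ f) (hg : IsCounterterm R γ g) : f = g := by
  have hd : f - g = postComp R ((f - g) * defect γ) := by
    rw [sub_mul, map_sub]
    nth_rewrite 1 [hf, hg]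
    abel
  -- The difference `d = R(d a)` lies in every step of the filtration, since `a` raises the degree.
  refine sub_eq_zero.1 (eq_zero_of_forall_mem_degFiltration (𝓗 := 𝓗) fun k => ?_)
  induction k with
  | zero => exact mem_degFiltration_zero _
  | succ k ih =>
    rw [hd]
    exact postComp_mem_degFiltration R
      (mul_mem_degFiltration h𝓗 ih (defect_mem_degFiltration h𝓗 γ))

lemma HasExpansion.isCounterterm (h𝓗 : IsConnectedGrading 𝓗) {R : A →ₗ[K] A} {γ : H →ₐ[K] A}
    {f : Lin K H A} (hf : HasExpansion 𝓗 (atkinson (postComp R) (defect γ)) f) :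
    IsCounterterm R γ f := by
  refine sub_eq_zero.1 (eq_zero_of_forall_mem_degFiltration (𝓗 := 𝓗) fun k => ?_)
  have h1 := degFiltration_mono k.le_succ (hf.sub_mem (k + 1))
  have h2 := postComp_mem_degFiltration R
    (mul_mem_degFiltration_left h𝓗 (hf.sub_mem k) (defect γ))
  rw [Finset.sum_range_succ'] at h1
  rw [sub_mul, map_sub, Finset.sum_mul, map_sum] at h2
  have h3 := Submodule.sub_mem _ h1 h2
  convert h3 using 1
  simp only [atkinson]
  abel

lemma IsCounterterm.hasExpansion (h𝓗 : IsConnectedGrading 𝓗) {R : A →ₗ[K] A} {γ : H →ₐ[K] A}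
    {f : Lin K H A} (hf : IsCounterterm R γ f) :
    HasExpansion 𝓗 (atkinson (postComp R) (defect γ)) f := by
  obtain ⟨g, hg⟩ := exists_hasExpansion (u := atkinson (postComp R) (defect γ))
    (atkinson_mem_degFiltration h𝓗 R (defect_mem_degFiltration h𝓗 γ))
  rwa [hf.eq h𝓗 (hg.isCounterterm h𝓗)]

end Counterterm

/-! ### Powers of a series -/

section Logarithm

variable {K H A : Type*} [Field K] [CommRing H] [HopfAlgebra K H] [CommRing A] [Algebra K A]

/-- The homogeneous part of weight `m` of `(u_1 + u_2 + ⋯) ^ k`. -/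
def powTerm {B : Type*} [Ring B] (u : ℕ → B) (k m : ℕ) : B :=
  ∑ J : Composition m, if J.blocks.length = k then (J.blocks.map u).prod else 0

lemma powTerm_succ_succ {B : Type*} [Ring B] (u : ℕ → B) (k m : ℕ) :
    powTerm u (k + 1) (m + 1) =
      ∑ i ∈ Finset.range (m + 1), powTerm u k i * u (m + 1 - i) := by
  unfold powTerm
  rw [sum_composition_succ (fun l => if l.length = k + 1 then (l.map u).prod else 0)]
  refine Finset.sum_congr rfl fun i _ => ?_
  rw [Finset.sum_mul]
  refine Finset.sum_congr rfl fun I _ => ?_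
  simp [ite_mul]

lemma powTerm_succ_zero {B : Type*} [Ring B] (u : ℕ → B) (k : ℕ) : powTerm u (k + 1) 0 = 0 := by
  refine Finset.sum_eq_zero fun J _ => if_neg ?_
  have : J.blocks = [] := by simp
  simp [this]

lemma powTerm_zero_zero {B : Type*} [Ring B] (u : ℕ → B) : powTerm u 0 0 = 1 := by
  have : ∀ J : Composition 0, J.blocks = [] := fun J => by simp
  simp [powTerm, this, composition_card]

lemma powTerm_zero_succ {B : Type*} [Ring B] (u : ℕ → B) (m : ℕ) : powTerm u 0 (m + 1) = 0 := by
  refine Finset.sum_eq_zero fun J _ => if_neg ?_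
  have := J.length_pos_iff.2 m.succ_pos
  exact this.ne'

variable {𝓗 : ℕ → Submodule K H}

lemma HasExpansion.pow (h𝓗 : IsConnectedGrading 𝓗) {u : ℕ → Lin K H A} (h0 : u 0 = 0)
    {f : Lin K H A} (hf : HasExpansion 𝓗 u f) (k : ℕ) : HasExpansion 𝓗 (powTerm u k) (f ^ k) := by
  induction k with
  | zero =>
    refine ⟨fun i => ?_, fun k => ?_⟩
    · cases i with
      | zero => exact mem_degFiltration_zero _
      | succ i => rw [powTerm_zero_succ]; exact zero_mem _
    · cases k with
      | zero => exact mem_degFiltration_zero _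
      | succ k => simp [Finset.sum_range_succ', powTerm_zero_succ, powTerm_zero_zero]
  | succ k ih =>
    rw [pow_succ]
    convert ih.mul h𝓗 hf using 1
    ext1 n
    cases n with
    | zero => simp [powTerm_succ_zero, h0]
    | succ n => rw [Finset.sum_range_succ, Nat.sub_self, h0, mul_zero, add_zero, powTerm_succ_succ]

end Logarithm

/-! ### The exponential formula -/

section ExponentialFormula

variable {K H A : Type*} [Field K] [CharZero K] [CommRing H] [HopfAlgebra K H] [CommRing A]
  [Algebra K A] {𝓗 : ℕ → Submodule K H}

/-- The part of weight `m` of `log (1 + u_1 + u_2 + ⋯)`, truncated at order `N ≥ m`, is given by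
the sum over all compositions of `m`. -/
lemma sum_powTerm_eq {B : Type*} [Ring B] [Algebra K B] (u : ℕ → B) {m N : ℕ} (hm : 0 < m)
    (hN : m ≤ N) :
    ∑ k ∈ Finset.range N, ((-1) ^ k / ((k : K) + 1)) • powTerm u (k + 1) m =
      ∑ J : Composition m, (((-1 : ℚ) ^ (J.length - 1) / J.length : ℚ) : K) •
        (J.blocks.map u).prod := by
  simp only [powTerm, Finset.smul_sum]
  rw [Finset.sum_comm]
  refine Finset.sum_congr rfl fun J _ => ?_
  have h1 : 0 < J.length := J.length_pos_iff.2 hm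
  have h2 := J.length_le
  rw [Finset.sum_eq_single_of_mem (J.length - 1) (Finset.mem_range.2 (by omega))]
  · rw [if_pos (by rw [J.blocks_length]; omega)]
    congr 1
    push_cast [Nat.cast_sub h1]
    simp
  · intro k _ hk
    rw [if_neg (by rw [J.blocks_length]; omega), smul_zero]

lemma combinatorialTerm_mem_degFiltration (h𝓗 : IsConnectedGrading 𝓗) {θ : K} {R : A →ₗ[K] A}
    (hR : IsRotaBaxter θ R) {a : Lin K H A} (ha : a ∈ degFiltration A 𝓗 1) (n : ℕ) :
    combinatorialTerm θ (postComp R) a n ∈ degFiltration A 𝓗 n := by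
  rw [combinatorialTerm_eq (isRotaBaxter_postComp hR)]
  refine Submodule.sum_mem _ fun J _ => Submodule.smul_mem _ _ ?_
  have := prod_atkinson_mem_degFiltration h𝓗 R ha J.blocks
  rwa [J.blocks_sum] at this

/-- If `1 + f` is the sum of the iterates `S_n`, then `∑ Ω_m` is congruent to the truncated
logarithm of `1 + f`. -/
lemma sub_aeval_logPoly_mem (h𝓗 : IsConnectedGrading 𝓗) {θ : K} {R : A →ₗ[K] A}
    (hR : IsRotaBaxter θ R) {a : Lin K H A} (ha : a ∈ degFiltration A 𝓗 1) {g L : Lin K H A}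
    (hg : HasExpansion 𝓗 (atkinson (postComp R) a) g)
    (hL : HasExpansion 𝓗 (fun i => combinatorialTerm θ (postComp R) a (i + 1)) L) (N : ℕ) :
    L - Polynomial.aeval (g - 1) (logPoly K N) ∈ degFiltration A 𝓗 (N + 1) := by
  set u : ℕ → Lin K H A := fun n => if n = 0 then 0 else atkinson (postComp R) a n with hu
  have hg' : HasExpansion 𝓗 u (g - 1) := by
    refine ⟨fun i => ?_, fun k => ?_⟩
    · simp only [hu]; split_ifs
      · exact zero_mem _
      · exact hg.mem i
    · cases k with
      | zero => exact mem_degFiltration_zero _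
      | succ k =>
        have := hg.sub_mem (k + 1)
        rw [Finset.sum_range_succ'] at this ⊢
        simp only [hu, Nat.succ_ne_zero, if_false, if_true, add_zero]
        convert this using 1
        simp only [atkinson]
        abel
  have hlog := HasExpansion.sum_smul (Finset.range N) (fun k : ℕ => (-1) ^ k / ((k : K) + 1))
    (fun k => hg'.pow h𝓗 (by simp [hu]) (k + 1))
  have hae : Polynomial.aeval (g - 1) (logPoly K N) =
      ∑ k ∈ Finset.range N, ((-1) ^ k / ((k : K) + 1)) • (g - 1) ^ (k + 1) := by
    rw [logPoly, map_sum]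
    refine Finset.sum_congr rfl fun k _ => ?_
    rw [map_mul, Polynomial.aeval_C, map_pow, Polynomial.aeval_X, Algebra.smul_def]
  rw [hae]
  have h1 := hlog.sub_mem (N + 1)
  have h2 := add_mem (hL.sub_mem (N + 1))
    (combinatorialTerm_mem_degFiltration h𝓗 hR ha (N + 1))
  have h3 : ∑ i ∈ Finset.range (N + 1), ∑ k ∈ Finset.range N,
      ((-1) ^ k / ((k : K) + 1)) • powTerm u (k + 1) i =
      ∑ i ∈ Finset.range N, combinatorialTerm θ (postComp R) a (i + 1) := by
    rw [Finset.sum_range_succ']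
    simp only [powTerm_succ_zero, smul_zero, Finset.sum_const_zero, add_zero]
    refine Finset.sum_congr rfl fun i hi => ?_
    rw [sum_powTerm_eq u i.succ_pos (Finset.mem_range.1 hi),
      combinatorialTerm_eq (isRotaBaxter_postComp hR)]
    refine Finset.sum_congr rfl fun J _ => ?_
    congr 2
    refine List.map_congr_left fun j hj => ?_
    simp [hu, (J.blocks_pos hj).ne']
  rw [h3] at h1
  rw [Finset.sum_range_succ] at h2
  convert sub_mem h2 h1 using 1
  abel

lemma isConvExp_of_hasExpansion (h𝓗 : IsConnectedGrading 𝓗) {θ : K} {R : A →ₗ[K] A}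
    (hR : IsRotaBaxter θ R) {a : Lin K H A} (ha : a ∈ degFiltration A 𝓗 1) {g L : Lin K H A}
    (hg : HasExpansion 𝓗 (atkinson (postComp R) a) g)
    (hL : HasExpansion 𝓗 (fun i => combinatorialTerm θ (postComp R) a (i + 1)) L) :
    IsConvExp 𝓗 L g := by
  have hL1 : L ∈ degFiltration A 𝓗 1 := by
    have := add_mem (hL.sub_mem 1) (combinatorialTerm_mem_degFiltration h𝓗 hR ha 1)
    simpa using this
  have hg1 : g - 1 ∈ degFiltration A 𝓗 1 := by simpa [atkinson] using hg.sub_mem 1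
  intro N
  refine ⟨N + 1, fun m hm x hx => ?_⟩
  suffices h : (∑ i ∈ Finset.range m, ((i.factorial : K)⁻¹) • L ^ i) - g ∈
      degFiltration A 𝓗 (N + 1) from sub_eq_zero.1 (h N (Nat.lt_succ_self N) x hx)
  set z := Polynomial.aeval (g - 1) (logPoly K N) with hz
  have hae : Polynomial.aeval z (expPoly K N) =
      ∑ i ∈ Finset.range (N + 1), ((i.factorial : K)⁻¹) • z ^ i := by
    rw [expPoly, map_sum]
    refine Finset.sum_congr rfl fun k _ => ?_
    rw [map_mul, Polynomial.aeval_C, map_pow, Polynomial.aeval_X, Algebra.smul_def]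
  -- The terms of order greater than `N` vanish in degree `N`.
  have h1 : (∑ i ∈ Finset.range m, ((i.factorial : K)⁻¹) • L ^ i) -
      ∑ i ∈ Finset.range (N + 1), ((i.factorial : K)⁻¹) • L ^ i ∈ degFiltration A 𝓗 (N + 1) := by
    rw [← Finset.sum_sdiff (Finset.range_subset_range.2 hm), add_sub_cancel_right]
    refine Submodule.sum_mem _ fun i hi => Submodule.smul_mem _ _
      (degFiltration_mono ?_ (pow_mem_degFiltration h𝓗 hL1 i))
    simpa using (Finset.mem_sdiff.1 hi).2
  have h2 : (∑ i ∈ Finset.range (N + 1), ((i.factorial : K)⁻¹) • L ^ i) -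
      Polynomial.aeval z (expPoly K N) ∈ degFiltration A 𝓗 (N + 1) := by
    rw [hae, ← Finset.sum_sub_distrib]
    refine Submodule.sum_mem _ fun i _ => ?_
    rw [← smul_sub]
    exact Submodule.smul_mem _ _
      (pow_sub_pow_mem_degFiltration h𝓗 (sub_aeval_logPoly_mem h𝓗 hR ha hg hL N) i)
  have h3 : Polynomial.aeval z (expPoly K N) - g ∈ degFiltration A 𝓗 (N + 1) := by
    obtain ⟨q, hq⟩ := X_pow_dvd_expPoly_comp_logPoly K N
    have := congrArg (Polynomial.aeval (g - 1)) hq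
    rw [map_sub, Polynomial.aeval_comp, ← hz, map_add, map_one, Polynomial.aeval_X, map_mul,
      map_pow, Polynomial.aeval_X, add_sub_cancel] at this
    rw [this]
    exact mul_mem_degFiltration_left h𝓗 (pow_mem_degFiltration h𝓗 hg1 _) _
  have := add_mem (add_mem h1 h2) h3
  simpa using this

end ExponentialFormula

/-! ### Integrals of monomials over a simplex -/

section SimplexIntegral

lemma omega_reverse_cons (x : ℕ) (l : List ℕ) :
    omega (x :: l).reverse = omega l.reverse * (((x :: l).sum : ℕ) : ℚ)⁻¹ := by
  rw [List.reverse_cons, omega_append_singleton, List.sum_reverse, List.sum_cons, add_comm]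

/-- The integral of a linear combination of monomials over the simplex of size `x`. -/
lemma simplexIntegral_sum_monomial {ι : Type*} (s : Finset ι) (n : ℕ) (x : ℝ) (c : ι → ℝ)
    (e : ι → Fin n → ℕ) (he : ∀ i k, 0 < e i k) :
    simplexIntegral n x (fun t => ∑ i ∈ s, c i * ∏ k, t k ^ (e i k - 1)) =
      ∑ i ∈ s, c i * (x ^ (∑ k, e i k) * (omega (List.ofFn (e i)).reverse : ℚ)) := by
  induction n generalizing x c with
  | zero => simp [simplexIntegral, omega]
  | succ n ih =>
    have hinner : ∀ t : ℝ, simplexIntegral n t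
        (fun u => ∑ i ∈ s, c i * ∏ k, (Fin.cons t u : Fin (n + 1) → ℝ) k ^ (e i k - 1)) =
        ∑ i ∈ s, c i * (omega (List.ofFn fun k => e i (Fin.succ k)).reverse : ℚ) *
          t ^ ((∑ k, e i k) - 1) := by
      intro t
      have h := ih t (fun i => c i * t ^ (e i 0 - 1)) (fun i k => e i k.succ)
        (fun i k => he i k.succ)
      simp only [Fin.prod_univ_succ, Fin.cons_zero, Fin.cons_succ, ← mul_assoc]
      rw [h]
      refine Finset.sum_congr rfl fun i _ => ?_
      rw [Fin.sum_univ_succ, show e i 0 + ∑ k : Fin n, e i k.succ - 1 =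
        (e i 0 - 1) + ∑ k : Fin n, e i k.succ by have := he i 0; omega, pow_add]
      ring
    rw [simplexIntegral]
    simp only [hinner]
    rw [intervalIntegral.integral_finsetSum fun i _ =>
      (by fun_prop : Continuous fun t : ℝ => c i * _ * t ^ _).intervalIntegrable _ _]
    refine Finset.sum_congr rfl fun i _ => ?_
    have hpos : 0 < ∑ k, e i k := by
      rw [Fin.sum_univ_succ]; have := he i 0; omega
    rw [intervalIntegral.integral_const_mul, integral_pow, List.ofFn_succ, omega_reverse_cons,
      List.sum_cons, List.sum_ofFn, ← Fin.sum_univ_succ, Nat.sub_add_cancel hpos,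
      zero_pow hpos.ne', sub_zero]
    have h1 : (((∑ k, e i k - 1 : ℕ) : ℝ) + 1) = ((∑ k, e i k : ℕ) : ℝ) := by
      exact_mod_cast congrArg (Nat.cast (R := ℝ)) (Nat.sub_add_cancel hpos)
    rw [h1]
    push_cast
    ring

end SimplexIntegral

/-! ### Linear extensions of unions of chains -/

section LinearExtensions

/-- The lists that enumerate a finite set without repetition. -/
def enumerations (s : Finset ℕ) : Finset (List ℕ) := s.val.lists.toFinset

lemma mem_enumerations {s : Finset ℕ} {l : List ℕ} :
    l ∈ enumerations s ↔ s.val = (l : Multiset ℕ) := by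
  rw [enumerations, Multiset.mem_toFinset, Multiset.mem_lists_iff]
  rfl

open Classical in
/-- The sum of `ω` over the linear extensions of the relation `r` on `s`. A linear extension is a
list of the elements of `s`, in decreasing order, and `r x y` requires that `x` be less than
`y`; the argument of `ω` is the list of the weights `w x`, taken in increasing order. -/
def linExtSum (r : ℕ → ℕ → Prop) (w : ℕ → ℕ) (s : Finset ℕ) : ℚ :=
  ∑ l ∈ enumerations s with l.Pairwise (fun x y => ¬ r x y), omega (l.map w).reverse

lemma cons_mem_enumerations {s : Finset ℕ} {x : ℕ} {l : List ℕ} :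
    x :: l ∈ enumerations s ↔ x ∈ s ∧ l ∈ enumerations (s.erase x) := by
  simp only [mem_enumerations, Finset.erase_val, ← Multiset.cons_coe]
  constructor
  · intro h
    refine ⟨by rw [← Finset.mem_val, h]; simp, by rw [h]; simp⟩
  · rintro ⟨hx, h⟩
    rw [← h, Multiset.cons_erase hx]

@[simp] lemma linExtSum_empty (r : ℕ → ℕ → Prop) (w : ℕ → ℕ) : linExtSum r w ∅ = 1 := by
  classical
  have : enumerations ∅ = {[]} := by
    ext l; simp [mem_enumerations, eq_comm (a := (0 : Multiset ℕ))]
  rw [linExtSum, this, Finset.sum_filter, Finset.sum_singleton]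
  simp [omega]

open Classical in
/-- Removing the greatest element from the linear extensions. -/
lemma sum_mul_linExtSum (r : ℕ → ℕ → Prop) {w : ℕ → ℕ} (hw : ∀ x, 0 < w x) (s : Finset ℕ) :
    ((∑ x ∈ s, w x : ℕ) : ℚ) * linExtSum r w s =
      ∑ x ∈ s with ∀ y ∈ s.erase x, ¬ r x y, linExtSum r w (s.erase x) := by
  rcases s.eq_empty_or_nonempty with rfl | hs
  · simp
  have hpos : ((∑ x ∈ s, w x : ℕ) : ℚ) ≠ 0 :=
    Nat.cast_ne_zero.2 (Finset.sum_pos (fun x _ => hw x) hs).ne'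
  simp only [linExtSum]
  rw [Finset.sum_sigma', Finset.mul_sum]
  symm
  refine Finset.sum_bij (fun p _ => p.1 :: p.2) ?_ ?_ ?_ ?_
  · rintro ⟨x, l⟩ h
    simp only [Finset.mem_sigma, Finset.mem_filter] at h ⊢
    refine ⟨cons_mem_enumerations.2 ⟨h.1.1, h.2.1⟩, List.pairwise_cons.2 ⟨fun y hy => ?_, h.2.2⟩⟩
    refine h.1.2 y ?_
    rw [← Finset.mem_val, mem_enumerations.1 h.2.1]
    exact hy
  · rintro ⟨x, l⟩ _ ⟨x', l'⟩ _ h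
    simp only [List.cons.injEq] at h
    obtain ⟨rfl, rfl⟩ := h
    rfl
  · intro l hl
    rw [Finset.mem_filter] at hl
    cases l with
    | nil =>
      have := mem_enumerations.1 hl.1
      exact absurd (Finset.val_eq_zero.1 this) hs.ne_empty
    | cons x l =>
      obtain ⟨h1, h2⟩ := cons_mem_enumerations.1 hl.1
      obtain ⟨h3, h4⟩ := List.pairwise_cons.1 hl.2
      refine ⟨⟨x, l⟩, ?_, rfl⟩
      simp only [Finset.mem_sigma, Finset.mem_filter]
      refine ⟨⟨h1, fun y hy => h3 y ?_⟩, h2, h4⟩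
      rw [← Finset.mem_val, mem_enumerations.1 h2] at hy
      exact hy
  · rintro ⟨x, l⟩ h
    simp only [Finset.mem_sigma, Finset.mem_filter] at h
    have h1 := cons_mem_enumerations.2 ⟨h.1.1, h.2.1⟩
    have h2 : ((x :: l).map w).sum = ∑ x ∈ s, w x := by
      rw [Finset.sum, mem_enumerations.1 h1]; simp
    change omega (l.map w).reverse = _ * omega ((x :: l).map w).reverse
    rw [List.map_cons, omega_reverse_cons, ← List.map_cons, h2]
    field_simp

/-- The sum over linear extensions is multiplicative on disjoint unions of unrelated sets. -/
lemma linExtSum_union {r : ℕ → ℕ → Prop} {w : ℕ → ℕ} (hw : ∀ x, 0 < w x) {s t : Finset ℕ}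
    (hst : Disjoint s t) (h : ∀ x ∈ s, ∀ y ∈ t, ¬ r x y) (h' : ∀ x ∈ s, ∀ y ∈ t, ¬ r y x) :
    linExtSum r w (s ∪ t) = linExtSum r w s * linExtSum r w t := by
  classical
  induction hn : (s ∪ t).card using Nat.strong_induction_on generalizing s t with
  | _ n ih =>
  rcases (s ∪ t).eq_empty_or_nonempty with he | hne
  · rw [Finset.union_eq_empty] at he
    simp [he.1, he.2]
  have hpos : ((∑ x ∈ s ∪ t, w x : ℕ) : ℚ) ≠ 0 :=
    Nat.cast_ne_zero.2 (Finset.sum_pos (fun x _ => hw x) hne).ne'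
  -- The greatest element of a linear extension of `s ∪ t` is removed either from `s` or from `t`.
  refine mul_left_cancel₀ hpos ?_
  have hs := sum_mul_linExtSum r hw s
  have ht := sum_mul_linExtSum r hw t
  rw [sum_mul_linExtSum r hw, Finset.sum_union hst, Nat.cast_add, add_mul, ← mul_assoc, hs,
    mul_left_comm, ht, Finset.filter_union, Finset.sum_union (Finset.disjoint_filter_filter hst),
    Finset.sum_mul, Finset.mul_sum]
  congr 1
  · have hf : (s.filter fun x => ∀ y ∈ (s ∪ t).erase x, ¬ r x y) =
        s.filter fun x => ∀ y ∈ s.erase x, ¬ r x y := by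
      refine Finset.filter_congr fun x hx => ⟨fun H y hy => H y ?_, fun H y hy => ?_⟩
      · exact Finset.erase_subset_erase _ Finset.subset_union_left hy
      · rcases Finset.mem_union.1 (Finset.mem_of_mem_erase hy) with hy' | hy'
        · exact H y (Finset.mem_erase.2 ⟨Finset.ne_of_mem_erase hy, hy'⟩)
        · exact h x hx y hy'
    rw [hf]
    refine Finset.sum_congr rfl fun x hx => ?_
    have hxs := (Finset.mem_filter.1 hx).1
    have hxt := Finset.disjoint_left.1 hst hxs
    have hsub : s.erase x ⊆ s := Finset.erase_subset _ _
    rw [Finset.erase_union_distrib, Finset.erase_eq_of_notMem hxt]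
    refine ih _ ?_ (hst.mono_left hsub) (fun x hx => h x (hsub hx))
      (fun x hx => h' x (hsub hx)) rfl
    rw [← hn]
    refine Finset.card_lt_card (Finset.ssubset_iff_of_subset
      (Finset.union_subset_union_left hsub) |>.2 ⟨x, Finset.mem_union_left _ hxs, ?_⟩)
    simp [hxt]
  · have hf : (t.filter fun x => ∀ y ∈ (s ∪ t).erase x, ¬ r x y) =
        t.filter fun x => ∀ y ∈ t.erase x, ¬ r x y := by
      refine Finset.filter_congr fun x hx => ⟨fun H y hy => H y ?_, fun H y hy => ?_⟩
      · exact Finset.erase_subset_erase _ Finset.subset_union_right hy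
      · rcases Finset.mem_union.1 (Finset.mem_of_mem_erase hy) with hy' | hy'
        · exact h' y hy' x hx
        · exact H y (Finset.mem_erase.2 ⟨Finset.ne_of_mem_erase hy, hy'⟩)
    rw [hf]
    refine Finset.sum_congr rfl fun x hx => ?_
    have hxt := (Finset.mem_filter.1 hx).1
    have hxs := Finset.disjoint_right.1 hst hxt
    have hsub : t.erase x ⊆ t := Finset.erase_subset _ _
    rw [Finset.erase_union_distrib, Finset.erase_eq_of_notMem hxs]
    refine ih _ ?_ (hst.mono_right hsub) (fun x hx y hy => h x hx y (hsub hy))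
      (fun x hx y hy => h' x hx y (hsub hy)) rfl
    rw [← hn]
    refine Finset.card_lt_card (Finset.ssubset_iff_of_subset
      (Finset.union_subset_union_right hsub) |>.2 ⟨x, Finset.mem_union_right _ hxt, ?_⟩)
    simp [hxs]

/-- The relation on `ℕ` under which consecutive integers `x`, `x + 1` are related unless there is a
cut at `x`. -/
def cutRel (S : Finset ℕ) (x y : ℕ) : Prop := y = x + 1 ∧ x ∉ S

/-- An interval without interior cuts is a chain, which has a single linear extension. -/
lemma linExtSum_chain {S : Finset ℕ} {w : ℕ → ℕ} (hw : ∀ x, 0 < w x) (p m : ℕ)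
    (hS : ∀ x, p ≤ x → x + 1 < p + m → x ∉ S) :
    linExtSum (cutRel S) w (Finset.Ico p (p + m)) = omega ((List.range' p m).map w) := by
  classical
  induction m with
  | zero => simp [omega]
  | succ m ih =>
    have hpos : ((∑ x ∈ Finset.Ico p (p + (m + 1)), w x : ℕ) : ℚ) ≠ 0 :=
      Nat.cast_ne_zero.2 (Finset.sum_pos (fun x _ => hw x) (by simp)).ne'
    have hf : ((Finset.Ico p (p + (m + 1))).filter fun x =>
        ∀ y ∈ (Finset.Ico p (p + (m + 1))).erase x, ¬ cutRel S x y) = {p + m} := by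
      ext x
      simp only [Finset.mem_filter, Finset.mem_Ico, Finset.mem_erase, Finset.mem_singleton, cutRel]
      constructor
      · rintro ⟨hx, H⟩
        by_contra hne
        exact H (x + 1) (by omega) ⟨rfl, hS x hx.1 (by omega)⟩
      · rintro rfl
        exact ⟨by omega, fun y hy h => by omega⟩
    have he : (Finset.Ico p (p + (m + 1))).erase (p + m) = Finset.Ico p (p + m) := by
      ext x; simp only [Finset.mem_erase, Finset.mem_Ico]; omega
    have hsum : ((List.range' p (m + 1)).map w).sum = ∑ x ∈ Finset.Ico p (p + (m + 1)), w x := by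
      rw [Finset.sum, Nat.Ico_eq_range', Nat.add_sub_cancel_left]
      simp
    refine mul_left_cancel₀ hpos ?_
    rw [sum_mul_linExtSum _ hw]
    refine (Finset.sum_congr (s₂ := {p + m}) (by convert hf) fun _ _ => rfl).trans ?_
    rw [Finset.sum_singleton, he,
      ih fun x hx hx' => hS x hx (by omega), ← hsum]
    rw [← hsum] at hpos
    rw [List.range'_1_concat, List.map_append, List.map_singleton] at hpos ⊢
    rw [List.sum_append, List.sum_singleton] at hpos ⊢
    rw [omega_append_singleton]
    field_simp

/-- If the cuts of an interval are those of the decomposition `D` of its list of weights, the sum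
over linear extensions is the product of the values of `ω` on the pieces. -/
lemma linExtSum_pieces {S : Finset ℕ} {w : ℕ → ℕ} (hw : ∀ x, 0 < w x) (D : List (List ℕ)) (p : ℕ)
    (hD : (List.range' p D.flatten.length).map w = D.flatten)
    (hS : ∀ x, p ≤ x → x + 1 < p + D.flatten.length →
      (x ∈ S ↔ ∃ i, x + 1 = p + ((D.map List.length).take i).sum)) :
    linExtSum (cutRel S) w (Finset.Ico p (p + D.flatten.length)) = (D.map omega).prod := by
  induction D generalizing p with
  | nil => simp
  | cons A D ih =>
    rw [List.flatten_cons, List.length_append] at hD hS ⊢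
    rw [← List.range'_append_1, List.map_append] at hD
    obtain ⟨hA, hD⟩ := List.append_inj hD (by simp)
    have hun : Finset.Ico p (p + (A.length + D.flatten.length)) =
        Finset.Ico p (p + A.length) ∪
          Finset.Ico (p + A.length) (p + A.length + D.flatten.length) := by
      rw [Finset.Ico_union_Ico_eq_Ico (by omega) (by omega), add_assoc]
    rw [hun, linExtSum_union hw (Finset.Ico_disjoint_Ico_consecutive _ _ _), linExtSum_chain hw,
      hA, ih _ hD, List.map_cons, List.prod_cons]
    · intro x hx hx'
      rw [hS x (by omega) (by omega)]
      constructor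
      · rintro ⟨i, hi⟩
        cases i with
        | zero => simp at hi; omega
        | succ i =>
          rw [List.map_cons, List.take_succ_cons, List.sum_cons] at hi
          exact ⟨i, by omega⟩
      · rintro ⟨i, hi⟩
        refine ⟨i + 1, ?_⟩
        rw [List.map_cons, List.take_succ_cons, List.sum_cons]
        omega
    · intro x hx hx' hmem
      rw [hS x hx (by omega)] at hmem
      obtain ⟨i, hi⟩ := hmem
      cases i with
      | zero => simp at hi; omega
      | succ i =>
        rw [List.map_cons, List.take_succ_cons, List.sum_cons] at hi
        omega
    · intro x hx y hy ⟨hxy, hnot⟩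
      rw [Finset.mem_Ico] at hx hy
      refine hnot ((hS x hx.1 (by omega)).2 ⟨1, ?_⟩)
      simp
      omega
    · intro x hx y hy ⟨hxy, _⟩
      rw [Finset.mem_Ico] at hx hy
      omega

end LinearExtensions

/-! ### The alternating sum over sets of cuts -/

section Descents

/-- The alternating sum over the sets of cuts that contain a given set of `d` cuts: a beta
integral. -/
lemma sum_powerset_neg_one_pow_div {α : Type*} [DecidableEq α] (C : Finset α) (d : ℕ) :
    ∑ T ∈ C.powerset, (-1 : ℚ) ^ (T.card + d) / (T.card + d + 1 : ℕ) =
      (-1) ^ d * (d.factorial * C.card.factorial) / (C.card + d + 1).factorial := by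
  induction C using Finset.induction_on generalizing d with
  | empty =>
    have := Nat.cast_ne_zero (R := ℚ).2 d.factorial_ne_zero
    simp [Nat.factorial_succ]
    field_simp
  | insert x C hx ih =>
    rw [Finset.sum_powerset_insert hx, ih d]
    have h : ∀ T ∈ C.powerset, (-1 : ℚ) ^ ((insert x T).card + d) / ((insert x T).card + d + 1 : ℕ) =
        (-1 : ℚ) ^ (T.card + (d + 1)) / (T.card + (d + 1) + 1 : ℕ) := by
      intro T hT
      rw [Finset.card_insert_of_notMem fun h => hx (Finset.mem_powerset.1 hT h),
        show T.card + 1 + d = T.card + (d + 1) by omega]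
    rw [Finset.sum_congr rfl h, ih (d + 1), Finset.card_insert_of_notMem hx,
      show C.card + 1 + d + 1 = C.card + d + 1 + 1 by omega,
      show C.card + (d + 1) + 1 = C.card + d + 1 + 1 by omega,
      Nat.factorial_succ (C.card + d + 1), Nat.factorial_succ C.card, Nat.factorial_succ d]
    have := Nat.cast_ne_zero (R := ℚ).2 (C.card + d + 1).factorial_ne_zero
    push_cast at *
    have h2 : (C.card : ℚ) + d + 1 + 1 ≠ 0 := by positivity
    field_simp
    ring

lemma sum_superset_neg_one_pow_div {q : ℕ} (D : Finset (Fin q)) :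
    ∑ T : Finset (Fin q) with D ⊆ T, (-1 : ℚ) ^ T.card / (T.card + 1 : ℕ) =
      (-1) ^ D.card / ((q + 1 : ℕ) * (q.choose D.card : ℚ)) := by
  have h := sum_powerset_neg_one_pow_div Dᶜ D.card
  have hcard : Dᶜ.card + D.card = q := by simp
  have hle : D.card ≤ q := by omega
  have hchoose := Nat.choose_mul_factorial_mul_factorial hle
  rw [show q - D.card = Dᶜ.card by omega] at hchoose
  have hrhs : (-1 : ℚ) ^ D.card / ((q + 1 : ℕ) * (q.choose D.card : ℚ)) =
      (-1) ^ D.card * (D.card.factorial * Dᶜ.card.factorial) / (Dᶜ.card + D.card + 1).factorial := by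
    rw [hcard, Nat.factorial_succ, ← hchoose]
    have h1 := Nat.cast_ne_zero (R := ℚ).2 D.card.factorial_ne_zero
    have h2 := Nat.cast_ne_zero (R := ℚ).2 Dᶜ.card.factorial_ne_zero
    have h3 := Nat.cast_ne_zero (R := ℚ).2 (Nat.choose_pos hle).ne'
    have h4 := Nat.cast_ne_zero (R := ℚ).2 q.succ_ne_zero
    push_cast at *
    field_simp
  rw [hrhs, ← h]
  symm
  refine Finset.sum_bij (fun T _ => T ∪ D) ?_ ?_ ?_ ?_
  · intro T _; simp
  · intro T hT T' hT' h
    have hd : ∀ T ∈ Dᶜ.powerset, (T ∪ D) \ D = T := fun T hT => by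
      rw [Finset.union_sdiff_right, Finset.sdiff_eq_self_iff_disjoint]
      exact Finset.subset_compl_iff_disjoint_right.1 (Finset.mem_powerset.1 hT)
    rw [← hd T hT, ← hd T' hT', h]
  · intro T hT
    refine ⟨T \ D, ?_, ?_⟩
    · rw [Finset.mem_powerset, Finset.subset_compl_iff_disjoint_right]
      exact Finset.sdiff_disjoint
    · exact Finset.sdiff_union_of_subset (Finset.mem_filter.1 hT).2
  · intro T hT
    rw [Finset.card_union_of_disjoint
      (Finset.subset_compl_iff_disjoint_right.1 (Finset.mem_powerset.1 hT))]

end Descents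

/-! ### Cuts of a composition -/

section Cuts

/-- The set of cuts of a composition `b` of `n`: the `i` with `0 ≤ i < n - 1` such that `i + 1` is a
partial sum of `b`. -/
def cuts {n : ℕ} (b : Composition n) : Finset (Fin (n - 1)) :=
  compositionAsSetEquiv n (compositionEquiv n b)

lemma mem_cuts {n : ℕ} {b : Composition n} {i : Fin (n - 1)} :
    i ∈ cuts b ↔ ∃ k, (i : ℕ) + 1 = b.sizeUpTo k := by
  have h : i ∈ cuts b ↔ (⟨1 + (i : ℕ), by omega⟩ : Fin n.succ) ∈ b.boundaries :=
    Set.mem_toFinset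
  rw [h, Composition.boundaries, Finset.mem_map]
  constructor
  · rintro ⟨k, _, hk⟩
    refine ⟨k, ?_⟩
    have := congrArg Fin.val hk
    change b.sizeUpTo k = 1 + (i : ℕ) at this
    omega
  · rintro ⟨k, hk⟩
    have hlt : k < b.length := by
      by_contra hle
      rw [b.sizeUpTo_ofLength_le k (by omega)] at hk
      omega
    refine ⟨⟨k, by omega⟩, Finset.mem_univ _, Fin.ext ?_⟩
    change b.sizeUpTo k = 1 + (i : ℕ)
    omega

lemma card_cuts_add_one {n : ℕ} (hn : 0 < n) (b : Composition n) :
    (cuts b).card + 1 = b.length := by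
  suffices hc : (cuts b).card = (Finset.Ico 1 b.length).card by
    have := b.length_pos_iff.2 hn
    rw [hc, Nat.card_Ico]; omega
  symm
  have hmono : ∀ j k, j < k → k ≤ b.length → b.sizeUpTo j < b.sizeUpTo k := by
    intro j k hjk hk
    exact (b.sizeUpTo_strict_mono (by omega)).trans_le (b.monotone_sizeUpTo hjk)
  have hb : ∀ k ∈ Finset.Ico 1 b.length, 0 < b.sizeUpTo k ∧ b.sizeUpTo k < n := by
    intro k hk
    rw [Finset.mem_Ico] at hk
    have h1 := hmono 0 k (by omega) (by omega)
    have h2 := hmono k b.length (by omega) le_rfl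
    rw [b.sizeUpTo_length] at h2
    rw [b.sizeUpTo_zero] at h1
    exact ⟨h1, h2⟩
  refine Finset.card_bij (fun k hk => ⟨b.sizeUpTo k - 1, by have := hb k hk; omega⟩) ?_ ?_ ?_
  · intro k hk
    have := hb k hk
    exact mem_cuts.2 ⟨k, Nat.sub_add_cancel this.1⟩
  · intro j hj k hk h
    have h1 := hb j hj
    have h2 := hb k hk
    have h3 : b.sizeUpTo j = b.sizeUpTo k := by
      have := congrArg Fin.val h
      dsimp only at this
      omega
    rw [Finset.mem_Ico] at hj hk
    rcases lt_trichotomy j k with h4 | h4 | h4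
    · have := hmono j k h4 (by omega); omega
    · exact h4
    · have := hmono k j h4 (by omega); omega
  · intro i hi
    obtain ⟨k, hk⟩ := mem_cuts.1 hi
    refine ⟨k, ?_, Fin.ext ?_⟩
    · rw [Finset.mem_Ico]
      constructor
      · by_contra h0
        obtain rfl : k = 0 := by omega
        simp at hk
      · by_contra hle
        rw [b.sizeUpTo_ofLength_le k (by omega)] at hk
        omega
    · dsimp only
      omega

lemma sum_composition_eq_sum_cuts {M : Type*} [AddCommMonoid M] {n : ℕ}
    (F : Finset (Fin (n - 1)) → M) :
    ∑ b : Composition n, F (cuts b) = ∑ T : Finset (Fin (n - 1)), F T :=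
  ((compositionEquiv n).trans (compositionAsSetEquiv n)).sum_comp F

end Cuts

/-! ### Compositions coarser than a given one -/

section Coarser

open Classical in
/-- The compositions coarser than `I` correspond to the compositions of the length of `I`. -/
lemma sum_coarser {M : Type*} [AddCommMonoid M] {m : ℕ} (I : Composition m) (F : ℕ → ℚ → M) :
    ∑ J ∈ Finset.univ.filter (fun J : Composition m => Finer J I), F J.length (omegaRel I J) =
      ∑ b : Composition I.length,
        F b.length ((I.blocks.splitWrtComposition b).map omega).prod := by
  have hdec : ∀ b : Composition I.length,
      IsDecomposition I (I.gather b) (I.blocks.splitWrtComposition b) := fun b =>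
    ⟨I.blocks.flatten_splitWrtComposition b, rfl⟩
  symm
  refine Finset.sum_bij (fun b _ => I.gather b) ?_ ?_ ?_ ?_
  · intro b _
    exact Finset.mem_filter.2 ⟨Finset.mem_univ _, _, hdec b⟩
  · intro b _ b' _ h
    have h1 := hdec b'
    rw [← h] at h1
    have h2 := congrArg (List.map List.length) ((hdec b).unique h1)
    rw [List.map_length_splitWrtComposition, List.map_length_splitWrtComposition] at h2
    exact Composition.ext h2
  · intro J hJ
    obtain ⟨D, hD⟩ := (Finset.mem_filter.1 hJ).2
    have hpos : ∀ {i}, i ∈ D.map List.length → 0 < i := by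
      intro i hi
      obtain ⟨A, hA, rfl⟩ := List.mem_map.1 hi
      refine List.length_pos_iff.2 fun hA0 => ?_
      have := J.blocks_pos (hD.2 ▸ List.mem_map_of_mem hA : A.sum ∈ J.blocks)
      simp [hA0] at this
    let b : Composition I.length := ⟨D.map List.length, hpos, by
      rw [← List.length_flatten, hD.1]⟩
    have hsplit : ∀ (l : List ℕ) (b : Composition l.length), D.flatten = l →
        D.map List.length = b.blocks → l.splitWrtComposition b = D := by
      rintro l b rfl h
      exact List.splitWrtComposition_flatten D b h
    refine ⟨b, Finset.mem_univ _, Composition.ext ?_⟩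
    change (I.blocks.splitWrtComposition b).map List.sum = J.blocks
    rw [hsplit _ b hD.1 rfl, hD.2]
  · intro b _
    rw [omegaRel_eq (hdec b), I.length_gather]

end Coarser

/-! ### The Strichartz coefficients -/

section Strichartz

/-- The enumeration `k ↦ n - 1 - σ⁻¹(k)` of `{0, …, n - 1}` attached to a permutation `σ`. -/
def permList {n : ℕ} (σ : Equiv.Perm (Fin n)) : List ℕ :=
  List.ofFn fun k => ((σ.symm k).rev : ℕ)

lemma sum_enumerations_range {M : Type*} [AddCommMonoid M] {n : ℕ} (F : List ℕ → M) :
    ∑ l ∈ enumerations (Finset.range n), F l = ∑ σ : Equiv.Perm (Fin n), F (permList σ) := by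
  symm
  refine Finset.sum_bij (fun σ _ => permList σ) ?_ ?_ ?_ ?_
  · intro σ _
    rw [mem_enumerations]
    refine (Multiset.Nodup.ext (Finset.nodup _) ?_).2 fun x => ?_
    · rw [Multiset.coe_nodup, permList, List.nodup_ofFn]
      exact Fin.val_injective.comp (Fin.rev_injective.comp σ.symm.injective)
    · rw [Multiset.mem_coe, permList, List.mem_ofFn, Finset.mem_val, Finset.mem_range]
      constructor
      · intro hx
        exact ⟨σ (Fin.rev ⟨x, hx⟩), by simp⟩
      · rintro ⟨k, rfl⟩
        exact Fin.is_lt _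
  · intro σ _ τ _ h
    have h1 := List.ofFn_injective h
    have h2 : σ.symm = τ.symm := by
      ext1 k
      exact Fin.rev_injective (Fin.val_injective (congrFun h1 k))
    exact Equiv.symm_bijective.injective h2
  · intro l hl
    rw [mem_enumerations] at hl
    have hlen : l.length = n := by
      have := congrArg Multiset.card hl
      simpa using this.symm
    have hnd : l.Nodup := by
      rw [← Multiset.coe_nodup, ← hl]; exact Finset.nodup _
    have hlt : ∀ k : Fin n, l[(k : ℕ)]'(by omega) < n := by
      intro k
      rw [← Finset.mem_range, ← Finset.mem_val, hl, Multiset.mem_coe]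
      exact List.getElem_mem _
    let g : Fin n → Fin n := fun k => Fin.rev ⟨l[(k : ℕ)]'(by omega), hlt k⟩
    have hg : Function.Injective g := by
      intro j k h
      have h1 := congrArg Fin.val (Fin.rev_injective h)
      exact Fin.ext ((hnd.getElem_inj_iff).1 h1)
    refine ⟨(Equiv.ofBijective g (Finite.injective_iff_bijective.1 hg)).symm, Finset.mem_univ _, ?_⟩
    rw [permList, Equiv.symm_symm]
    refine List.ext_getElem (by simp [hlen]) fun k h1 h2 => ?_
    simp [g]
  · intro _ _; rfl

/-- The positions `x` such that `x + 1` comes after `x` in the decreasing enumeration attached to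
`σ`. Reversal of `{0, …, n - 2}` maps them to the descents of `σ`. -/
def forcedCuts {n : ℕ} (σ : Equiv.Perm (Fin n)) : Finset (Fin (n - 1)) :=
  Finset.univ.filter fun x =>
    σ (Fin.rev ⟨x, by omega⟩) < σ (Fin.rev ⟨x + 1, by omega⟩)

lemma card_forcedCuts {n : ℕ} (σ : Equiv.Perm (Fin n)) : (forcedCuts σ).card = descents σ := by
  refine Finset.card_bij (fun x _ => Fin.rev ⟨x + 1, by omega⟩) ?_ ?_ ?_
  · intro x hx
    have hx' := (Finset.mem_filter.1 hx).2
    refine Finset.mem_filter.2 ⟨Finset.mem_univ _, by simp only [Fin.val_rev]; omega, ?_⟩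
    convert hx' using 2
    ext
    simp only [Fin.val_rev]
    omega
  · intro x _ y _ h
    have := congrArg Fin.val (Fin.rev_injective h)
    simp only at this
    exact Fin.ext (by omega)
  · intro i hi
    obtain ⟨_, hi1, hi2⟩ := Finset.mem_filter.1 hi
    refine ⟨⟨n - 2 - i, by omega⟩, Finset.mem_filter.2 ⟨Finset.mem_univ _, ?_⟩, ?_⟩
    · convert hi2 using 2 <;> ext <;> simp only [Fin.val_rev] <;> omega
    · ext; simp only [Fin.val_rev]; omega

lemma pairwise_permList_iff {n : ℕ} (σ : Equiv.Perm (Fin n)) (T : Finset (Fin (n - 1))) :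
    (permList σ).Pairwise (fun x y => ¬ cutRel (T.map Fin.valEmbedding) x y) ↔
      forcedCuts σ ⊆ T := by
  rw [permList, List.pairwise_ofFn]
  constructor
  · intro h x hx
    have hx' := (Finset.mem_filter.1 hx).2
    have h1 := h hx'
    by_contra hT
    refine h1 ⟨by simp, ?_⟩
    simp only [Equiv.symm_apply_apply, Fin.rev_rev, Finset.mem_map, Fin.valEmbedding_apply]
    rintro ⟨y, hy, hyx⟩
    exact hT (Fin.ext hyx ▸ hy)
  · rintro h i j hij ⟨h1, h2⟩
    have hlt := (σ.symm j).rev.is_lt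
    have hx : (⟨((σ.symm i).rev : ℕ), by omega⟩ : Fin (n - 1)) ∈ forcedCuts σ := by
      refine Finset.mem_filter.2 ⟨Finset.mem_univ _, ?_⟩
      have e1 : (⟨((σ.symm i).rev : ℕ), Fin.is_lt _⟩ : Fin n).rev = σ.symm i :=
        Fin.rev_rev _
      have e2 : (⟨((σ.symm i).rev : ℕ) + 1, by omega⟩ : Fin n) = (σ.symm j).rev := Fin.ext h1.symm
      simp only [e2]
      rw [e1, Fin.rev_rev, Equiv.apply_symm_apply, Equiv.apply_symm_apply]
      exact hij
    exact h2 (Finset.mem_map.2 ⟨_, h hx, rfl⟩)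

/-- The coefficients of the combinatorial form of `Ω_m`, as sums over permutations. -/
lemma logCoeff_eq_sum_perm {m : ℕ} (hm : 0 < m) (I : Composition m) :
    logCoeff I = ∑ σ : Equiv.Perm (Fin I.length),
      (-1 : ℚ) ^ descents σ / (I.length * ((I.length - 1).choose (descents σ) : ℚ)) *
        omega (List.ofFn fun k => I.blocksFun (σ.symm k).rev).reverse := by
  classical
  have hn : 0 < I.length := I.length_pos_iff.2 hm
  -- The default value `1` keeps the weights positive on all of `ℕ`.
  set w : ℕ → ℕ := fun x => I.blocks.getD x 1 with hw
  have hwpos : ∀ x, 0 < w x := by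
    intro x
    rcases lt_or_ge x I.blocks.length with hx | hx
    · simp only [hw, List.getD_eq_getElem _ _ hx]
      exact I.blocks_pos (List.getElem_mem _)
    · simp only [hw]
      rw [List.getD_eq_default _ _ hx]
      exact one_pos
  have hpiece : ∀ b : Composition I.length,
      ((I.blocks.splitWrtComposition b).map omega).prod =
        linExtSum (cutRel ((cuts b).map Fin.valEmbedding)) w (Finset.range I.length) := by
    intro b
    have hfl := I.blocks.flatten_splitWrtComposition b
    have h := linExtSum_pieces (S := (cuts b).map Fin.valEmbedding) hwpos
      (I.blocks.splitWrtComposition b) 0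
    rw [hfl, List.map_length_splitWrtComposition, Nat.zero_add, ← Finset.range_eq_Ico] at h
    refine (h ?_ ?_).symm
    · refine List.ext_getElem (by simp) fun k h1 h2 => ?_
      simp [hw, h2]
    · intro x _ hx
      have hx' : x < I.length - 1 := by rw [I.blocks_length] at hx; omega
      have h1 : x ∈ (cuts b).map Fin.valEmbedding ↔ (⟨x, hx'⟩ : Fin (I.length - 1)) ∈ cuts b := by
        rw [Finset.mem_map]
        constructor
        · rintro ⟨y, hy, rfl⟩; exact hy
        · intro hy; exact ⟨_, hy, rfl⟩
      rw [h1, mem_cuts]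
      simp [Composition.sizeUpTo]
  have hmap : ∀ σ : Equiv.Perm (Fin I.length),
      (permList σ).map w = List.ofFn fun k => I.blocksFun (σ.symm k).rev := by
    intro σ
    rw [permList, List.map_ofFn]
    congr 1
    ext1 k
    simp only [hw, Function.comp_apply]
    rw [List.getD_eq_getElem _ _ (by rw [I.blocks_length]; exact Fin.is_lt _)]
    rfl
  have hext : ∀ T : Finset (Fin (I.length - 1)),
      linExtSum (cutRel (T.map Fin.valEmbedding)) w (Finset.range I.length) =
        ∑ σ : Equiv.Perm (Fin I.length), if forcedCuts σ ⊆ T then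
          omega (List.ofFn fun k => I.blocksFun (σ.symm k).rev).reverse else 0 := by
    intro T
    rw [linExtSum, Finset.sum_filter, sum_enumerations_range]
    refine Finset.sum_congr rfl fun σ _ => ?_
    rw [hmap]
    exact if_congr (pairwise_permList_iff σ T) rfl rfl
  rw [logCoeff, sum_coarser I fun l q => (-1 : ℚ) ^ (l - 1) / l * q]
  set F : Finset (Fin (I.length - 1)) → ℚ := fun T => (-1 : ℚ) ^ T.card / (T.card + 1 : ℕ) *
    linExtSum (cutRel (T.map Fin.valEmbedding)) w (Finset.range I.length) with hF
  have hb : ∀ b : Composition I.length, (-1 : ℚ) ^ (b.length - 1) / b.length *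
      ((I.blocks.splitWrtComposition b).map omega).prod =
      F (cuts b) := by
    intro b
    simp only [hF]
    rw [hpiece, ← card_cuts_add_one hn b, Nat.add_sub_cancel]
  rw [Finset.sum_congr rfl fun b _ => hb b, sum_composition_eq_sum_cuts F]
  simp only [hF, hext, Finset.mul_sum]
  rw [Finset.sum_comm]
  refine Finset.sum_congr rfl fun σ _ => ?_
  have h := sum_superset_neg_one_pow_div (forcedCuts σ)
  rw [card_forcedCuts, Nat.sub_add_cancel hn, Finset.sum_filter] at h
  rw [← h, Finset.sum_mul]
  refine Finset.sum_congr rfl fun T _ => ?_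
  split_ifs <;> simp

/-- The Strichartz coefficients are those of the combinatorial form of `Ω_m`. -/
lemma logCoeff_eq_strichartzCoeff {m : ℕ} (hm : 0 < m) (I : Composition m) :
    (logCoeff I : ℝ) = strichartzCoeff I := by
  have hprod : ∀ (t : Fin I.length → ℝ) (σ : Equiv.Perm (Fin I.length)),
      ∏ j : Fin I.length, t (σ j.rev) ^ (I.blocksFun j - 1) =
        ∏ k, t k ^ (I.blocksFun (σ.symm k).rev - 1) := by
    intro t σ
    refine Fintype.prod_equiv (Fin.revPerm.trans σ) _ _ fun j => ?_
    simp
  rw [strichartzCoeff]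
  simp only [hprod]
  refine Eq.trans ?_ (simplexIntegral_sum_monomial Finset.univ I.length 1
    (fun σ : Equiv.Perm (Fin I.length) => (-1 : ℝ) ^ descents σ /
      (I.length * ((I.length - 1).choose (descents σ) : ℝ)))
    (fun σ k => I.blocksFun (σ.symm k).rev) (fun σ k => I.one_le_blocksFun _)).symm
  rw [logCoeff_eq_sum_perm hm]
  push_cast
  simp

end Strichartz

end Bogoliubov

end


theorem mainTheorem9 {K H A : Type*} [Field K] [CharZero K]
    [CommRing H] [HopfAlgebra K H] (𝓗 : ℕ → Submodule K H) [GradedAlgebra 𝓗]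
    (h𝓗 : Bogoliubov.IsConnectedGrading 𝓗)
    [CommRing A] [Algebra K A] (R : A →ₗ[K] A)
    (hR : Bogoliubov.IsRotaBaxter (-1 : K) R) (hidem : ∀ x : A, R (R x) = R x)
    (γ : H →ₐ[K] A) :
    (∃! γm : Bogoliubov.Lin K H A, Bogoliubov.IsCounterterm R γ γm) ∧
    ∃ c : (m : ℕ) → Composition m → ℚ,
      (∀ m, 0 < m → ∀ I : Composition m, (c m I : ℝ) = Bogoliubov.strichartzCoeff I) ∧
      ∃ Ω : ℕ → Bogoliubov.Lin K H A,
        (∀ m, Ω m = ∑ I : Composition m, (c m I : K) •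
          Bogoliubov.bigLProd (-1 : K) (Bogoliubov.postComp R) (Bogoliubov.defect γ) I) ∧
        (∀ n, 0 < n → Ω n = Bogoliubov.combinatorialTerm (-1 : K) (Bogoliubov.postComp R)
          (Bogoliubov.defect γ) n) ∧
        ∃ Ωtot : Bogoliubov.Lin K H A,
          Bogoliubov.HasGradedSum 𝓗 (fun i => Ω (i + 1)) Ωtot ∧
          ∀ γm : Bogoliubov.Lin K H A, Bogoliubov.IsCounterterm R γ γm →
            Bogoliubov.IsConvExp 𝓗 Ωtot γm := by
  have ha := Bogoliubov.defect_mem_degFiltration h𝓗 γ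
  obtain ⟨g, hg⟩ := Bogoliubov.exists_hasExpansion
    (Bogoliubov.atkinson_mem_degFiltration h𝓗 R ha)
  obtain ⟨L, hL⟩ := Bogoliubov.exists_hasExpansion fun i =>
    Bogoliubov.degFiltration_mono i.le_succ
      (Bogoliubov.combinatorialTerm_mem_degFiltration h𝓗 hR ha (i + 1))
  refine ⟨⟨g, hg.isCounterterm h𝓗, fun f hf => hf.eq h𝓗 (hg.isCounterterm h𝓗)⟩,
    fun m I => Bogoliubov.logCoeff I, fun m hm I => Bogoliubov.logCoeff_eq_strichartzCoeff hm I,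
    Bogoliubov.combinatorialTerm (-1 : K) (Bogoliubov.postComp R) (Bogoliubov.defect γ),
    fun m => Bogoliubov.combinatorialTerm_eq_sum_logCoeff _ _ _ m, fun _ _ => rfl,
    L, hL.hasGradedSum, fun γm hγm => ?_⟩
  exact Bogoliubov.isConvExp_of_hasExpansion h𝓗 hR ha (hγm.hasExpansion h𝓗) hL
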